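/- Let $N\ge 1$ and let $p_1,\dots,p_N\ge 0$ satisfy $p_1+\dots+p_N=1$. Put $Q(z)=\sum_{j=1}^N p_j z^j$ and, for $\rho\in L^1(\mathbb R)$, $\mathbb Q[\rho]=\sum_{j=1}^N p_j\,\rho^{*j}$, where $\rho^{*j}$ is the $j$-fold convolution power. Let $\phi$ be the analytic function on the open unit disk with $\phi'(z)=\frac{1}{1-Q(z)}$ and $\phi(0)=0$ (for $Q(z)=z^2$ this is $\phi(z)=\frac12\log\frac{1+z}{1-z}$). Let $$\mathbb P=\Big\{\eta\in L^1((1,\infty),\mathbb R_+)\ :\ \int_1^\infty\eta(y)\,dy=1\Big\},$$ whose elements are extended by $0$ to $\mathbb R$. For functions on $[1,\infty)$, extended by $0$ to $\mathbb R$, and $\tau\ge 0$, put $(S_\tau w)(y)=e^\tau w(e^\tau y)$ if $y\ge 1$ and $(S_\tau w)(y)=0$ if $y<1$; also put $(T_1f)(y)=f(y-1)$ if $y\ge 2$ and $(T_1f)(y)=0$ if $y<2$. Write $(\mathcal F f)(\xi)=\int_1^\infty e^{-i\xi x}f(x)\,dx$ for complex $\xi$ with $\operatorname{Im}\xi<0$,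 and for $\rho\in\mathbb P$ let $\mathcal N(\rho)=(\mathcal F^{-1}\circ\phi\circ\mathcal F)(\rho)$, that is, $\mathcal N(\rho)$ is the function $w\in L^1_{\rm loc}([1,\infty),\mathbb R)$ (unique up to null sets) such that $e^{-\varepsilon x}w(x)$ is integrable on $(1,\infty)$ for all $\varepsilon>0$ and $\mathcal F w(\xi)=\phi(\mathcal F\rho(\xi))$ for all $\xi$ with $\operatorname{Im}\xi<0$. Let $\eta_0\in\mathbb P$ and let $\eta\in C^0([0,\infty),\mathbb P)$, with $\mathbb P$ carrying the $L^1$ norm topology, be the solution of $$\eta(\tau)=S_\tau\eta_0+\int_0^\tau\beta(s)\,S_{\tau-s}T_1\mathbb Q[\eta(s)]\,ds\qquad(\tau\ge 0),$$ where the trace $\beta$ of $\eta$ is given by $\beta(\tau)=e^{\tau-\tau_0}\,\eta(\tau_0,e^{\tau-\tau_0})$ for all $\tau_0\ge 0$ and almost all $\tau\in[\tau_0,\tau_0+\log 2]$. Then, for all $\tau\ge 0$, $\mathcal N(\eta(\tau))$ exists and $$\mathcal N(\eta(\tau))=S_\tau\,\mathcal N(\eta_0)\qquad\text{almost everywhere.}$$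 -/

import Mathlib

open MeasureTheory Set

noncomputable section

namespace Coarsening

/-- The polynomial `Q(z) = p₁ z + ⋯ + p_N z^N` on the complex plane. -/
def Qpoly (N : ℕ) (p : ℕ → ℝ) (z : ℂ) : ℂ :=
  ∑ j ∈ Finset.Icc 1 N, (p j : ℂ) * z ^ j

/-- The convolution power `ρ^{*j} = ρ * ⋯ * ρ` (`j ≥ 1` factors) on the real line.
The value at `j = 0`, which is never used, is set to `0`. -/
def convPow (ρ : ℝ → ℝ) : ℕ → ℝ → ℝ
  | 0 => 0
  | 1 => ρ
  | j + 2 => convolution ρ (convPow ρ (j + 1)) (ContinuousLinearMap.mul ℝ ℝ) volume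

/-- The convolution polynomial `ℚ[ρ] = ∑_{j=1}^N p_j ρ^{*j}`. -/
def Qconv (N : ℕ) (p : ℕ → ℝ) (ρ : ℝ → ℝ) : ℝ → ℝ :=
  fun x => ∑ j ∈ Finset.Icc 1 N, p j * convPow ρ j x

/-- The shift operator: `(T₁ f)(y) = f(y - 1)` if `y ≥ 2`, and `0` if `y < 2`. -/
def shiftOne (f : ℝ → ℝ) : ℝ → ℝ :=
  indicator (Ici 2) fun y => f (y - 1)

/-- The dilation operator: `(S_τ f)(y) = e^τ f(e^τ y)` if `y ≥ 1`, and `0` if `y < 1`. -/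
def dilation (τ : ℝ) (f : ℝ → ℝ) : ℝ → ℝ :=
  indicator (Ici 1) fun y => Real.exp τ * f (Real.exp τ * y)

theorem integrable_convPow {ρ : ℝ → ℝ} (hρ : Integrable ρ) :
    ∀ j : ℕ, Integrable (convPow ρ j)
  | 0 => integrable_zero _ _ _
  | 1 => hρ
  | j + 2 => hρ.integrable_convolution (ContinuousLinearMap.mul ℝ ℝ)
      (integrable_convPow hρ (j + 1))

theorem integrable_Qconv (N : ℕ) (p : ℕ → ℝ) {ρ : ℝ → ℝ} (hρ : Integrable ρ) :
    Integrable (Qconv N p ρ) :=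
  integrable_finsetSum _ fun j _ => (integrable_convPow hρ j).const_mul (p j)

theorem integrable_shiftOne {f : ℝ → ℝ} (hf : Integrable f) : Integrable (shiftOne f) :=
  (hf.comp_sub_right 1).indicator measurableSet_Ici

theorem integrable_dilation (τ : ℝ) {f : ℝ → ℝ} (hf : Integrable f) :
    Integrable (dilation τ f) :=
  ((hf.comp_mul_left' (Real.exp_ne_zero τ)).const_mul (Real.exp τ)).indicator measurableSet_Ici

/-- The Banach space `L¹(ℝ)`. The space `L¹((1,∞))` is identified, through extension by zero,
with the closed subspace of those elements that vanish almost everywhere below `1`. -/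
abbrev L1R : Type := Lp ℝ 1 (volume : Measure ℝ)

/-- `S_τ` as a map of `L¹`. -/
def dilationL1 (τ : ℝ) (f : L1R) : L1R :=
  (integrable_dilation τ (L1.integrable_coeFn f)).toL1 (dilation τ f)

/-- The map `f ↦ T₁ ℚ[f]` of `L¹`. -/
def shiftQconvL1 (N : ℕ) (p : ℕ → ℝ) (f : L1R) : L1R :=
  (integrable_shiftOne (integrable_Qconv N p (L1.integrable_coeFn f))).toL1
    (shiftOne (Qconv N p f))

/-- The set `ℙ` of probability densities on `(1,∞)`, extended by zero to `ℝ`. -/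
def probDensities : Set L1R :=
  {f | (∀ᵐ x, x < 1 → f x = 0) ∧ (∀ᵐ x, 0 ≤ f x) ∧ ∫ x in Ioi (1 : ℝ), f x = 1}

/-- `β` is the trace of `η`: for every `τ₀ ≥ 0`, one has
`β(τ) = e^{τ-τ₀} η(τ₀, e^{τ-τ₀})` for almost all `τ` in `[τ₀, τ₀ + log 2]`. -/
def IsTrace (η : ℝ → L1R) (β : ℝ → ℝ) : Prop :=
  ∀ τ₀ : ℝ, 0 ≤ τ₀ → ∀ᵐ τ : ℝ, τ ∈ Icc τ₀ (τ₀ + Real.log 2) →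
    β τ = Real.exp (τ - τ₀) * η τ₀ (Real.exp (τ - τ₀))

/-- `η ∈ C⁰([0,∞), ℙ)` is a solution with initial value `η₀` of the rescaled coarsening equation
`∂_τ η = ∂_y (y η) + β(τ) T₁ ℚ[η]`, in the integrated form
`η(τ) = S_τ η₀ + ∫_0^τ β(s) S_{τ-s} T₁ ℚ[η(s)] ds` (a Bochner integral in `L¹`),
where `β` is the trace of `η`. Only the values `η τ` with `τ ≥ 0` matter. -/
structure IsSolution (N : ℕ) (p : ℕ → ℝ) (η₀ : L1R) (η : ℝ → L1R) : Prop where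
  continuousOn : ContinuousOn η (Ici 0)
  mem : ∀ τ : ℝ, 0 ≤ τ → η τ ∈ probDensities
  integral_eq : ∃ β : ℝ → ℝ, IsTrace η β ∧ ∀ τ : ℝ, 0 ≤ τ →
    η τ = dilationL1 τ η₀ + ∫ s in (0 : ℝ)..τ, β s • dilationL1 (τ - s) (shiftQconvL1 N p (η s))

/-- The function `φ` with `φ' = 1 / (1 - Q)` and `φ(0) = 0` on the open unit disk, written as the
integral of `1 / (1 - Q)` along the segment from `0` to `z`. -/
def phi (N : ℕ) (p : ℕ → ℝ) (z : ℂ) : ℂ :=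
  ∫ t in (0 : ℝ)..1, z / (1 - Qpoly N p (t * z))

/-- The Fourier transform `∫_1^∞ e^{-iξx} f(x) dx` of a function on `[1,∞)`, at a complex `ξ`
of the lower half plane. -/
def fourier (f : ℝ → ℝ) (ξ : ℂ) : ℂ :=
  ∫ x in Ioi (1 : ℝ), Complex.exp (-Complex.I * ξ * x) * (f x : ℂ)

/-- `w ∈ L¹_loc([1,∞), ℝ)`, extended by zero to `ℝ`, has Fourier transform `g` in the open lower
half plane. The integrability of `e^{-εx} w(x)` for all `ε > 0` says that the integral which
defines the Fourier transform converges absolutely there. -/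
structure HasFourier (w : ℝ → ℝ) (g : ℂ → ℂ) : Prop where
  eq_zero : ∀ x : ℝ, x < 1 → w x = 0
  locallyIntegrableOn : LocallyIntegrableOn w (Ici 1)
  integrable_exp : ∀ ε : ℝ, 0 < ε →
    IntegrableOn (fun x : ℝ => Real.exp (-ε * x) * w x) (Ioi 1)
  fourier_eq : ∀ ξ : ℂ, ξ.im < 0 → fourier w ξ = g ξ

open Classical in
/-- The inverse Fourier transform `𝓕⁻¹ g`: the function `w ∈ L¹_loc([1,∞), ℝ)` (unique up to a null
set) whose Fourier transform in the open lower half plane is `g`; `0` if there is none. -/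
def fourierInv (g : ℂ → ℂ) : ℝ → ℝ :=
  if h : ∃ w, HasFourier w g then h.choose else 0

/-- The nonlinear map `𝒩 = 𝓕⁻¹ ∘ φ ∘ 𝓕`. -/
def Nmap (N : ℕ) (p : ℕ → ℝ) (ρ : ℝ → ℝ) : ℝ → ℝ :=
  fourierInv fun ξ => phi N p (fourier ρ ξ)

end Coarsening

end

open MeasureTheory Set

noncomputable section

namespace Coarsening

open Filter Topology

/-! The map `𝒩` linearises the flow along characteristics. Fix `ξ` in the lower half plane and put
`y(s) = 𝓕(η(s))(e^s ξ)`. The integrated equation, tested against exponentials, becomes `y' = -β(s)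
e^{-i e^s ξ} (1 - Q(y))` in integrated form (`IsSolution.fourier_sub_eq`). Since `φ' = 1/(1-Q)`,
this says `(φ ∘ y)' = -β(s) e^{-i e^s ξ}`, with no nonlinearity left (`chain_rule_of_integral_eq`).

A density living on `(1,∞)` satisfies `|𝓕η(ζ)| ≤ e^{Im ζ}`, so `y` stays in the unit disk and `y(T)
→ 0` as `T → ∞`. Hence `φ(y(τ)) = ∫_τ^∞ β(s) e^{-i e^s ξ} ds`. With `x = e^s` the right side is the
Fourier transform, over `(e^τ,∞)`, of the single profile `w(x) = β(log x)/x`; after rescaling the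
frequency it is the transform of `S_τ w`. Thus `𝒩(η(τ)) = S_τ w` for every `τ ≥ 0`, and `τ = 0`
gives `w = 𝒩(η₀)`. Absolute convergence comes from `ξ = -iε`, where the integrand is nonnegative,
and uniqueness of the inverse transform from `HasFourier.ae_eq`. -/

/-! ### The polynomial `Q` and the function `φ` on the unit disk. -/

theorem continuous_Qpoly (N : ℕ) (p : ℕ → ℝ) : Continuous (Qpoly N p) := by
  unfold Qpoly; fun_prop

theorem differentiable_Qpoly (N : ℕ) (p : ℕ → ℝ) : Differentiable ℂ (Qpoly N p) := by
  unfold Qpoly; fun_prop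

theorem norm_Qpoly_le {N : ℕ} {p : ℕ → ℝ} (hp : ∀ j ∈ Finset.Icc 1 N, 0 ≤ p j)
    (hp1 : ∑ j ∈ Finset.Icc 1 N, p j = 1)
    {z : ℂ} (hz : ‖z‖ ≤ 1) : ‖Qpoly N p z‖ ≤ ‖z‖ := by
  calc ‖Qpoly N p z‖ ≤ ∑ j ∈ Finset.Icc 1 N, p j * ‖z‖ := by
        refine norm_sum_le_of_le _ fun j hj => ?_
        rw [norm_mul, norm_pow, Complex.norm_real, Real.norm_of_nonneg (hp j hj)]
        exact mul_le_mul_of_nonneg_left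
          (pow_le_of_le_one (norm_nonneg _) hz (by have := Finset.mem_Icc.1 hj; lia)) (hp j hj)
    _ = ‖z‖ := by rw [← Finset.sum_mul, hp1, one_mul]

theorem one_sub_Qpoly_ne_zero {N : ℕ} {p : ℕ → ℝ} (hp : ∀ j ∈ Finset.Icc 1 N, 0 ≤ p j)
    (hp1 : ∑ j ∈ Finset.Icc 1 N, p j = 1)
    {z : ℂ} (hz : ‖z‖ < 1) : 1 - Qpoly N p z ≠ 0 := by
  intro h
  have h1 := norm_Qpoly_le hp hp1 hz.le
  rw [← sub_eq_zero.1 h, norm_one] at h1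
  linarith

theorem phi_zero (N : ℕ) (p : ℕ → ℝ) : phi N p 0 = 0 := by simp [phi]

/-- The holomorphic function `1/(1-Q)` has some primitive `F` on the disk; the fundamental theorem
of calculus along the segment from `0` identifies `phi` with `F - F 0`. -/
theorem hasDerivAt_phi {N : ℕ} {p : ℕ → ℝ} (hp : ∀ j ∈ Finset.Icc 1 N, 0 ≤ p j)
    (hp1 : ∑ j ∈ Finset.Icc 1 N, p j = 1)
    {z : ℂ} (hz : ‖z‖ < 1) :
    HasDerivAt (phi N p) (1 / (1 - Qpoly N p z)) z := by
  have hd : DifferentiableOn ℂ (fun z => 1 / (1 - Qpoly N p z)) (Metric.ball 0 1) := by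
    intro w hw
    have hw' : ‖w‖ < 1 := by simpa using hw
    refine DifferentiableAt.differentiableWithinAt ?_
    exact (differentiableAt_const _).div
      ((differentiableAt_const _).sub (differentiable_Qpoly N p w))
      (one_sub_Qpoly_ne_zero hp hp1 hw')
  obtain ⟨F, hF⟩ := hd.isExactOn_ball
  have key : ∀ w ∈ Metric.ball (0 : ℂ) 1, phi N p w = F w - F 0 := by
    intro w hw
    have hw' : ‖w‖ < 1 := by simpa using hw
    have hmem : ∀ t ∈ uIcc (0 : ℝ) 1, ‖(t : ℂ) * w‖ < 1 := by
      intro t ht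
      rw [uIcc_of_le zero_le_one] at ht
      rw [norm_mul, Complex.norm_real, Real.norm_of_nonneg ht.1]
      calc t * ‖w‖ ≤ 1 * ‖w‖ := mul_le_mul_of_nonneg_right ht.2 (norm_nonneg _)
        _ < 1 := by simpa using hw'
    have hderiv : ∀ t ∈ uIcc (0 : ℝ) 1,
        HasDerivAt (fun t : ℝ => F (t * w)) (w / (1 - Qpoly N p (t * w))) t := by
      intro t ht
      have h1 : HasDerivAt (fun s : ℝ => (s : ℂ) * w) w t := by
        simpa using (Complex.ofRealCLM.hasDerivAt (x := t)).mul_const w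
      have h2 := (hF _ (by simpa using hmem t ht)).comp t h1
      refine h2.congr_deriv ?_
      simp only [div_eq_inv_mul, mul_one]
    have hcont : ContinuousOn (fun t : ℝ => w / (1 - Qpoly N p (t * w))) (uIcc 0 1) := by
      refine continuousOn_const.div ?_ fun t ht => one_sub_Qpoly_ne_zero hp hp1 (hmem t ht)
      have := continuous_Qpoly N p
      fun_prop
    have := intervalIntegral.integral_eq_sub_of_hasDerivAt hderiv hcont.intervalIntegrable
    simpa [phi] using this
  have hz' : z ∈ Metric.ball (0 : ℂ) 1 := by simpa using hz
  refine ((hF z hz').sub_const (F 0)).congr_of_eventuallyEq ?_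
  filter_upwards [Metric.isOpen_ball.mem_nhds hz'] with w hw using key w hw

/-! ### A chain rule for curves driven by a locally integrable coefficient. -/

/-- Chain rule for an integral curve `y` of `y' = -k h(y)`, where `k` is merely locally
integrable, and a function `φ` with `φ' = 1 / h`. -/
theorem chain_rule_of_integral_eq {h φ : ℂ → ℂ} {y k : ℝ → ℂ} {δ T : ℝ} (hδ : 0 < δ)
    (hT : 0 ≤ T)
    (hcont : Continuous h) (h2 : ∀ z, ‖z‖ < 1 → ‖h z‖ ≤ 2) (h0 : ∀ z, ‖z‖ < 1 → h z ≠ 0)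
    (hφ : ∀ z, ‖z‖ < 1 → HasDerivAt φ (1 / h z) z)
    (hk : ∀ a b, 0 ≤ a → 0 ≤ b → IntervalIntegrable k volume a b)
    (hy1 : ∀ t, 0 ≤ t → ‖y t‖ < 1)
    (hy : ∀ s t, 0 ≤ s → s ≤ t → t ≤ s + δ → y t - y s = -∫ u in s..t, k u * h (y u)) :
    φ (y T) = φ (y 0) - ∫ u in (0 : ℝ)..T, k u := by
  -- `M` serves as the clock: as `‖h‖ ≤ 2`, increments of `y` over short times are at most twice
  -- those of `M`. Continuity of `y` is deduced from this.
  set M : ℝ → ℝ := fun t => ∫ u in (0 : ℝ)..t, ‖k u‖ with hM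
  have hMdiff : ∀ s t, 0 ≤ s → 0 ≤ t → M t - M s = ∫ u in s..t, ‖k u‖ := fun s t hs ht =>
    intervalIntegral.integral_interval_sub_left (hk 0 t le_rfl ht).norm (hk 0 s le_rfl hs).norm
  have hMcont : ContinuousOn M (Icc 0 T) := by
    have := intervalIntegral.continuousOn_primitive_interval (μ := volume)
      (f := fun u => ‖k u‖) (a := 0) (b := T)
    rw [uIcc_of_le hT] at this
    refine this ?_
    rw [integrableOn_Icc_iff_integrableOn_Ioc]
    exact (intervalIntegrable_iff_integrableOn_Ioc_of_le hT).1 (hk 0 T le_rfl hT).norm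
  have hKcont : ContinuousOn (fun t => ∫ u in (0 : ℝ)..t, k u) (Icc 0 T) := by
    have := intervalIntegral.continuousOn_primitive_interval (μ := volume)
      (f := k) (a := 0) (b := T)
    rw [uIcc_of_le hT] at this
    refine this ?_
    rw [integrableOn_Icc_iff_integrableOn_Ioc]
    exact (intervalIntegrable_iff_integrableOn_Ioc_of_le hT).1 (hk 0 T le_rfl hT)
  have hybd : ∀ s t, 0 ≤ s → s ≤ t → t ≤ s + δ → ‖y t - y s‖ ≤ 2 * (M t - M s) := by
    intro s t hs hst htδ
    rw [hy s t hs hst htδ, norm_neg, hMdiff s t hs (hs.trans hst),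
      ← intervalIntegral.integral_const_mul]
    refine intervalIntegral.norm_integral_le_of_norm_le hst ?_
      ((hk s t hs (hs.trans hst)).norm.const_mul 2)
    refine Eventually.of_forall fun u hu => ?_
    rw [norm_mul, mul_comm]
    exact mul_le_mul_of_nonneg_right (h2 _ (hy1 u (hs.trans hu.1.le))) (norm_nonneg _)
  have hycont : ContinuousOn y (Icc 0 T) := by
    intro x hx
    have hM0 : Tendsto (fun t => 2 * |M t - M x|) (𝓝[Icc 0 T] x) (𝓝 0) := by
      have := (((hMcont x hx).sub_const (M x)).abs.const_mul 2)
      simpa using this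
    refine tendsto_iff_norm_sub_tendsto_zero.2 (squeeze_zero' (Eventually.of_forall fun _ =>
      norm_nonneg _) ?_ hM0)
    have hnear : ∀ᶠ t in 𝓝[Icc 0 T] x, |t - x| < δ :=
      nhdsWithin_le_nhds (Metric.ball_mem_nhds x hδ)
    filter_upwards [hnear, self_mem_nhdsWithin] with t ht htm
    rw [abs_lt] at ht
    rcases le_total x t with hxt | hxt
    · exact (hybd x t hx.1 hxt (by linarith)).trans
        (mul_le_mul_of_nonneg_left (le_abs_self _) zero_le_two)
    · rw [norm_sub_rev, abs_sub_comm]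
      exact (hybd t x htm.1 hxt (by linarith)).trans
        (mul_le_mul_of_nonneg_left (le_abs_self _) zero_le_two)
  set G : ℝ → ℂ := fun t => φ (y t) + ∫ u in (0 : ℝ)..t, k u with hG
  have hGcont : ContinuousOn G (Icc 0 T) := by
    refine ContinuousOn.add (fun x hx => ?_) hKcont
    exact (hφ _ (hy1 x hx.1)).continuousAt.comp_continuousWithinAt (hycont x hx)
  -- Constancy of `G` by continuous induction on a closed set of times. In `3 * ε`, a share `2 * ε`
  -- is the linearisation error of `φ` at `y x`, and `ε` is the cost of replacing `h (y u)` by `h (y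
  -- x)`.
  have main : ∀ ε > 0, ‖G T - G 0‖ ≤ (3 * ε) * M T := by
    intro ε hε
    have hclosed : IsClosed ({t | ‖G t - G 0‖ ≤ (3 * ε) * M t} ∩ Icc 0 T) := by
      rw [inter_comm]
      exact isClosed_Icc.isClosed_le (hGcont.sub continuousOn_const).norm
        (hMcont.const_smul (3 * ε))
    refine hclosed.Icc_subset_of_forall_mem_nhdsWithin (by simp [hM]) ?_ (right_mem_Icc.2 hT)
    rintro x ⟨hxm, hx0, hxT⟩
    have hxI : x ∈ Icc 0 T := ⟨hx0, hxT.le⟩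
    have hyR : Tendsto y (𝓝[≥] x) (𝓝 (y x)) := by
      have : Tendsto y (𝓝[Icc x T] x) (𝓝 (y x)) :=
        (hycont x hxI).mono_left (nhdsWithin_mono _ (Icc_subset_Icc_left hx0))
      rwa [nhdsWithin_Icc_eq_nhdsGE hxT] at this
    have hz := hy1 x hx0
    have e1 : ∀ᶠ t in 𝓝[≥] x,
        ‖φ (y t) - φ (y x) - (y t - y x) • (1 / h (y x))‖ ≤ ε * ‖y t - y x‖ :=
      hyR.eventually ((hφ _ hz).isLittleO.def hε)
    have e2 : ∀ᶠ t in 𝓝[≥] x, ‖1 - h (y t) / h (y x)‖ < ε := by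
      have : ContinuousAt (fun z => ‖1 - h z / h (y x)‖) (y x) := by fun_prop
      refine hyR.eventually (this.eventually (gt_mem_nhds ?_))
      simpa [div_self (h0 _ hz)] using hε
    obtain ⟨r, hr, hrs⟩ := mem_nhdsGE_iff_exists_Ico_subset.1 (e1.and e2)
    have hr : x < r := hr
    have hev : Ioo x (min (min r T) (x + δ)) ∈ 𝓝[>] x :=
      Ioo_mem_nhdsGT (by simp [hr, hxT, hδ])
    filter_upwards [hev] with t ht
    obtain ⟨hxt, ht2⟩ := ht
    simp only [lt_min_iff] at ht2
    obtain ⟨⟨htr, htT⟩, htδ⟩ := ht2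
    have ht0 : 0 ≤ t := hx0.trans hxt.le
    have hb1 := (hrs ⟨hxt.le, htr⟩).1
    have hkx := hk x t hx0 ht0
    have hprod : IntervalIntegrable (fun u => k u * h (y u)) volume x t := by
      refine hkx.mul_continuousOn ?_
      rw [uIcc_of_le hxt.le]
      exact hcont.comp_continuousOn (hycont.mono (Icc_subset_Icc hx0 htT.le))
    have hsplit : G t - G x = (φ (y t) - φ (y x) - (y t - y x) • (1 / h (y x)))
        + ∫ u in x..t, k u * (1 - h (y u) / h (y x)) := by
      have hKd : (∫ u in (0 : ℝ)..t, k u) - ∫ u in (0 : ℝ)..x, k u = ∫ u in x..t, k u :=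
        intervalIntegral.integral_interval_sub_left (hk 0 t le_rfl ht0) (hk 0 x le_rfl hx0)
      have hI : ∫ u in x..t, k u * (1 - h (y u) / h (y x))
          = (∫ u in x..t, k u) - (∫ u in x..t, k u * h (y u)) * (1 / h (y x)) := by
        rw [← intervalIntegral.integral_mul_const,
          ← intervalIntegral.integral_sub hkx (hprod.mul_const _)]
        congr 1 with u
        ring
      rw [hI, hy x t hx0 hxt.le htδ.le, ← hKd, hG]
      simp only [smul_eq_mul]
      ring
    have hb2 : ‖∫ u in x..t, k u * (1 - h (y u) / h (y x))‖ ≤ ε * (M t - M x) := by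
      rw [hMdiff x t hx0 ht0, ← intervalIntegral.integral_const_mul]
      refine intervalIntegral.norm_integral_le_of_norm_le hxt.le ?_ (hkx.norm.const_mul ε)
      refine Eventually.of_forall fun u hu => ?_
      rw [norm_mul, mul_comm]
      exact mul_le_mul_of_nonneg_right (hrs ⟨hu.1.le, hu.2.trans_lt htr⟩).2.le (norm_nonneg _)
    have hb3 := hybd x t hx0 hxt.le htδ.le
    have hfin : ‖G t - G x‖ ≤ 3 * ε * (M t - M x) := by
      rw [hsplit]
      refine (norm_add_le _ _).trans ?_
      nlinarith [mul_le_mul_of_nonneg_left hb3 hε.le]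
    have hxm' : ‖G x - G 0‖ ≤ 3 * ε * M x := hxm
    change ‖G t - G 0‖ ≤ 3 * ε * M t
    calc ‖G t - G 0‖ = ‖(G t - G x) + (G x - G 0)‖ := by ring_nf
      _ ≤ ‖G t - G x‖ + ‖G x - G 0‖ := norm_add_le _ _
      _ ≤ 3 * ε * M t := by linarith
  have hGeq : ‖G T - G 0‖ ≤ 0 := by
    have hlim : Tendsto (fun ε : ℝ => (3 * ε) * M T) (𝓝[>] 0) (𝓝 0) := by
      have : Continuous (fun ε : ℝ => (3 * ε) * M T) := by fun_prop
      simpa using (this.tendsto 0).mono_left nhdsWithin_le_nhds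
    exact ge_of_tendsto hlim (by filter_upwards [self_mem_nhdsWithin] with ε hε using main ε hε)
  have := sub_eq_zero.1 (norm_le_zero_iff.1 hGeq)
  simp only [hG, intervalIntegral.integral_same, add_zero] at this
  rw [← this]; ring

/-! ### Continuity in `L¹` of `T₁ ℚ` and of the dilations. -/

/-- Write `f * g - f' * g' = (f - f') * g' + f * (g - g')` and bound each term by the convolution of
absolute values, whose integral factorises. -/
theorem integral_norm_convolution_sub_le {f f' g g' : ℝ → ℝ} (hf : Integrable f)
    (hf' : Integrable f') (hg : Integrable g) (hg' : Integrable g') :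
    ∫ x, ‖convolution f g (ContinuousLinearMap.mul ℝ ℝ) volume x
        - convolution f' g' (ContinuousLinearMap.mul ℝ ℝ) volume x‖
      ≤ (∫ x, ‖f x - f' x‖) * (∫ x, ‖g' x‖) + (∫ x, ‖f x‖) * ∫ x, ‖g x - g' x‖ := by
  have hff : Integrable fun x => f x - f' x := hf.sub hf'
  have hgg : Integrable fun x => g x - g' x := hg.sub hg'
  have i1 := hff.norm.integrable_convolution (ContinuousLinearMap.mul ℝ ℝ) hg'.norm
  have i2 := hf.norm.integrable_convolution (ContinuousLinearMap.mul ℝ ℝ) hgg.norm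
  have e1 := integral_convolution (ContinuousLinearMap.mul ℝ ℝ) hff.norm hg'.norm
  have e2 := integral_convolution (ContinuousLinearMap.mul ℝ ℝ) hf.norm hgg.norm
  simp only [ContinuousLinearMap.mul_apply'] at e1 e2
  rw [← e1, ← e2, ← integral_add i1 i2]
  refine integral_mono_ae ((hf.integrable_convolution _ hg).sub
    (hf'.integrable_convolution _ hg')).norm (i1.add i2) ?_
  filter_upwards [hf.ae_convolution_exists (ContinuousLinearMap.mul ℝ ℝ) hg,
    hf'.ae_convolution_exists (ContinuousLinearMap.mul ℝ ℝ) hg',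
    hff.norm.ae_convolution_exists (ContinuousLinearMap.mul ℝ ℝ) hg'.norm,
    hf.norm.ae_convolution_exists (ContinuousLinearMap.mul ℝ ℝ) hgg.norm] with x h1 h2 h3 h4
  simp only [ConvolutionExistsAt, ContinuousLinearMap.mul_apply'] at h1 h2 h3 h4
  simp only [convolution, ContinuousLinearMap.mul_apply']
  rw [← integral_sub h1 h2, ← integral_add h3 h4]
  refine norm_integral_le_of_norm_le (h3.add h4) (Eventually.of_forall fun t => ?_)
  rw [← norm_mul, ← norm_mul]
  refine le_trans (le_of_eq ?_) (norm_add_le _ _)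
  congr 1; ring

theorem tendsto_integral_norm_convPow_sub {ι : Type*} {l : Filter ι} {F : ι → ℝ → ℝ}
    {f : ℝ → ℝ} (hF : ∀ i, Integrable (F i)) (hf : Integrable f)
    (h : Tendsto (fun i => ∫ x, ‖F i x - f x‖) l (𝓝 0)) :
    ∀ j, Tendsto (fun i => ∫ x, ‖convPow (F i) j x - convPow f j x‖) l (𝓝 0)
  | 0 => by simpa [convPow] using tendsto_const_nhds
  | 1 => h
  | j + 2 => by
    have ih := tendsto_integral_norm_convPow_sub hF hf h (j + 1)
    have hb : ∀ i, ∫ x, ‖F i x‖ ≤ (∫ x, ‖F i x - f x‖) + ∫ x, ‖f x‖ := by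
      intro i
      have hd : Integrable fun x => F i x - f x := (hF i).sub hf
      rw [← integral_add hd.norm hf.norm]
      refine integral_mono (hF i).norm (hd.norm.add hf.norm) fun x => ?_
      simpa using norm_add_le (F i x - f x) (f x)
    have hlim : Tendsto (fun i => (∫ x, ‖F i x - f x‖) * (∫ x, ‖convPow f (j + 1) x‖)
        + ((∫ x, ‖F i x - f x‖) + ∫ x, ‖f x‖)
          * ∫ x, ‖convPow (F i) (j + 1) x - convPow f (j + 1) x‖) l (𝓝 0) := by
      have := (h.mul_const (∫ x, ‖convPow f (j + 1) x‖)).add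
        ((h.add_const (∫ x, ‖f x‖)).mul ih)
      simpa using this
    refine squeeze_zero (fun i => integral_nonneg fun x => norm_nonneg _) (fun i => ?_) hlim
    refine (integral_norm_convolution_sub_le (hF i) hf (integrable_convPow (hF i) (j + 1))
      (integrable_convPow hf (j + 1))).trans ?_
    gcongr
    exact hb i

theorem tendsto_integral_norm_Qconv_sub {ι : Type*} {l : Filter ι} {F : ι → ℝ → ℝ}
    {f : ℝ → ℝ} (N : ℕ) (p : ℕ → ℝ) (hF : ∀ i, Integrable (F i)) (hf : Integrable f)
    (h : Tendsto (fun i => ∫ x, ‖F i x - f x‖) l (𝓝 0)) :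
    Tendsto (fun i => ∫ x, ‖Qconv N p (F i) x - Qconv N p f x‖) l (𝓝 0) := by
  have hlim : Tendsto (fun i => ∑ j ∈ Finset.Icc 1 N,
      |p j| * ∫ x, ‖convPow (F i) j x - convPow f j x‖) l (𝓝 0) := by
    have := tendsto_finsetSum (Finset.Icc 1 N) fun j _ =>
      (tendsto_integral_norm_convPow_sub hF hf h j).const_mul |p j|
    simpa using this
  refine squeeze_zero (fun i => integral_nonneg fun x => norm_nonneg _) (fun i => ?_) hlim
  have hint : ∀ j, Integrable fun x => convPow (F i) j x - convPow f j x := fun j =>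
    (integrable_convPow (hF i) j).sub (integrable_convPow hf j)
  simp_rw [← integral_const_mul]
  rw [← integral_finsetSum _ fun j _ => (hint j).norm.const_mul _]
  refine integral_mono ((integrable_Qconv N p (hF i)).sub (integrable_Qconv N p hf)).norm
    (integrable_finsetSum _ fun j _ => (hint j).norm.const_mul _) fun x => ?_
  simp only [Qconv, ← Finset.sum_sub_distrib]
  refine norm_sum_le_of_le _ fun j _ => ?_
  rw [← mul_sub, norm_mul, Real.norm_eq_abs]

theorem dist_toL1_eq {f g : ℝ → ℝ} (hf : Integrable f) (hg : Integrable g) :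
    dist (hf.toL1 f) (hg.toL1 g) = ∫ x, ‖f x - g x‖ := by
  rw [dist_eq_norm, ← Integrable.toL1_sub, L1.norm_of_fun_eq_integral_norm]
  rfl

theorem dist_eq_integral_norm_sub (f g : L1R) : dist f g = ∫ x, ‖f x - g x‖ := by
  conv_lhs => rw [← Integrable.toL1_coeFn f (L1.integrable_coeFn f),
    ← Integrable.toL1_coeFn g (L1.integrable_coeFn g)]
  exact dist_toL1_eq _ _

theorem integral_norm_shiftOne_sub_le {f g : ℝ → ℝ} (hf : Integrable f) (hg : Integrable g) :
    ∫ x, ‖shiftOne f x - shiftOne g x‖ ≤ ∫ x, ‖f x - g x‖ := by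
  rw [← integral_sub_right_eq_self (fun x => ‖f x - g x‖) 1]
  refine integral_mono ((integrable_shiftOne hf).sub (integrable_shiftOne hg)).norm
    ((hf.sub hg).norm.comp_sub_right 1) fun x => ?_
  by_cases hx : x ∈ Ici (2 : ℝ)
  · simp [shiftOne, indicator_of_mem hx]
  · simp [shiftOne, indicator_of_notMem hx]

/-- With the joint continuity of the dilations, this makes the integrand of the evolution equation
Bochner integrable, so that bounded functionals pass through the integral. -/
theorem continuous_shiftQconvL1 (N : ℕ) (p : ℕ → ℝ) : Continuous (shiftQconvL1 N p) := by
  rw [continuous_iff_continuousAt]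
  intro f
  refine tendsto_iff_dist_tendsto_zero.2 ?_
  have h : Tendsto (fun g : L1R => ∫ x, ‖g x - f x‖) (𝓝 f) (𝓝 0) := by
    simp_rw [← dist_eq_integral_norm_sub]
    exact tendsto_iff_dist_tendsto_zero.1 tendsto_id
  refine squeeze_zero (fun _ => dist_nonneg) (fun g => ?_)
    (tendsto_integral_norm_Qconv_sub N p (fun g : L1R => L1.integrable_coeFn g)
      (L1.integrable_coeFn f) h)
  rw [shiftQconvL1, shiftQconvL1, dist_toL1_eq]
  exact integral_norm_shiftOne_sub_le (integrable_Qconv N p (L1.integrable_coeFn g))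
    (integrable_Qconv N p (L1.integrable_coeFn f))

theorem quasiMeasurePreserving_mul_left_of_ne_zero {a : ℝ} (ha : a ≠ 0) :
    Measure.QuasiMeasurePreserving (fun x : ℝ => a * x) volume volume := by
  refine ⟨measurable_const_mul a, ?_⟩
  rw [Real.map_volume_mul_left ha]
  exact Measure.smul_absolutelyContinuous

theorem dilation_congr_ae (τ : ℝ) {f g : ℝ → ℝ} (h : f =ᵐ[volume] g) :
    dilation τ f =ᵐ[volume] dilation τ g := by
  have := (quasiMeasurePreserving_mul_left_of_ne_zero (Real.exp_ne_zero τ)).ae_eq_comp h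
  filter_upwards [this] with x hx
  simp only [Function.comp_apply] at hx
  simp only [dilation, indicator, hx]

theorem integral_norm_dilation_sub_le (τ : ℝ) {f g : ℝ → ℝ} (hf : Integrable f)
    (hg : Integrable g) :
    ∫ x, ‖dilation τ f x - dilation τ g x‖ ≤ ∫ x, ‖f x - g x‖ := by
  have h1 : ∫ x, Real.exp τ * ‖f (Real.exp τ * x) - g (Real.exp τ * x)‖
      = ∫ x, ‖f x - g x‖ := by
    rw [integral_const_mul, Measure.integral_comp_mul_left (fun x => ‖f x - g x‖),
      smul_eq_mul, ← mul_assoc, abs_of_pos (by positivity),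
      mul_inv_cancel₀ (Real.exp_ne_zero τ), one_mul]
  rw [← h1]
  refine integral_mono ((integrable_dilation τ hf).sub (integrable_dilation τ hg)).norm
    (((hf.sub hg).norm.comp_mul_left' (Real.exp_ne_zero τ)).const_mul _) fun x => ?_
  by_cases hx : x ∈ Ici (1 : ℝ)
  · simp [dilation, indicator_of_mem hx, ← mul_sub]
  · simp only [dilation, indicator_of_notMem hx, sub_zero, norm_zero]
    positivity

theorem dist_dilationL1_le (τ : ℝ) (f g : L1R) :
    dist (dilationL1 τ f) (dilationL1 τ g) ≤ dist f g := by
  rw [dilationL1, dilationL1, dist_toL1_eq, dist_eq_integral_norm_sub]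
  exact integral_norm_dilation_sub_le τ (L1.integrable_coeFn f) (L1.integrable_coeFn g)

theorem dilationL1_toL1 (τ : ℝ) {f : ℝ → ℝ} (hf : Integrable f) :
    dilationL1 τ (hf.toL1 f) = (integrable_dilation τ hf).toL1 (dilation τ f) := by
  rw [dilationL1, Integrable.toL1_eq_toL1_iff]
  exact dilation_congr_ae τ hf.coeFn_toL1

theorem continuous_dilationL1_toL1 {g : ℝ → ℝ} (hc : Continuous g) (hs : HasCompactSupport g)
    (hg : Integrable g) : Continuous fun τ => dilationL1 τ (hg.toL1 g) := by
  rw [continuous_iff_continuousAt]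
  intro τ
  simp only [dilationL1_toL1]
  refine tendsto_iff_dist_tendsto_zero.2 ?_
  simp only [dist_toL1_eq]
  obtain ⟨C, hC⟩ := hc.bounded_above_of_compact_support hs
  obtain ⟨R, hR⟩ := hs.isCompact.isBounded.subset_closedBall (0 : ℝ)
  have hC0 : 0 ≤ C := (norm_nonneg _).trans (hC 0)
  -- A dominating function uniform in `σ`: `g` vanishes beyond `R`, and `e^σ x ≤ R` with `σ > τ - 1`
  -- forces `x ≤ R e^{1-τ}`.
  have hbd : ∀ σ ∈ Ioo (τ - 1) (τ + 1), ∀ x, ‖dilation σ g x‖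
      ≤ (Icc 1 (R * Real.exp (1 - τ))).indicator (fun _ => Real.exp (τ + 1) * C) x := by
    intro σ hσ x
    by_cases hx : x ∈ Icc 1 (R * Real.exp (1 - τ))
    · rw [indicator_of_mem hx, dilation, indicator_of_mem (mem_Ici.2 hx.1), norm_mul, Real.norm_eq_abs,
        Real.abs_exp]
      exact mul_le_mul (Real.exp_le_exp.2 hσ.2.le) (hC _) (norm_nonneg _) (Real.exp_pos _).le
    · rw [indicator_of_notMem hx, dilation]
      by_cases hx1 : x ∈ Ici (1 : ℝ)
      · have hx2 : R * Real.exp (1 - τ) < x := by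
          by_contra! hcon
          exact hx ⟨hx1, hcon⟩
        have : g (Real.exp σ * x) = 0 := by
          by_contra hne
          have hmem := hR (subset_tsupport g hne)
          have hx0 : 0 < x := lt_of_lt_of_le one_pos hx1
          rw [mem_closedBall_zero_iff, Real.norm_eq_abs, abs_of_pos (by positivity)] at hmem
          have h3 : Real.exp (τ - 1) ≤ Real.exp σ := Real.exp_le_exp.2 hσ.1.le
          have h4 : R * Real.exp (1 - τ) * Real.exp (τ - 1) < x * Real.exp (τ - 1) :=
            mul_lt_mul_of_pos_right hx2 (Real.exp_pos _)
          rw [mul_assoc, ← Real.exp_add] at h4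
          simp only [sub_add_sub_cancel, sub_self, Real.exp_zero, mul_one] at h4
          nlinarith [mul_le_mul_of_nonneg_left h3 hx0.le]
        simp [indicator_of_mem hx1, this]
      · simp [indicator_of_notMem hx1]
  have hlim : Tendsto (fun σ => ∫ x, ‖dilation σ g x - dilation τ g x‖) (𝓝 τ)
      (𝓝 (∫ _ : ℝ, (0 : ℝ))) := by
    refine tendsto_integral_filter_of_dominated_convergence
      (fun x => (Icc 1 (R * Real.exp (1 - τ))).indicator
        (fun _ => Real.exp (τ + 1) * C) x + ‖dilation τ g x‖) ?_ ?_ ?_ ?_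
    · exact Eventually.of_forall fun σ =>
        ((integrable_dilation σ hg).sub (integrable_dilation τ hg)).norm.aestronglyMeasurable
    · filter_upwards [Ioo_mem_nhds (sub_one_lt τ) (lt_add_one τ)] with σ hσ
      refine Eventually.of_forall fun x => ?_
      rw [norm_norm]
      exact (norm_sub_le _ _).trans (add_le_add_left (hbd σ hσ x) _)
    · refine Integrable.add ?_ (integrable_dilation τ hg).norm
      exact (integrable_indicator_iff measurableSet_Icc).2
        (integrableOn_const isCompact_Icc.measure_lt_top.ne)
    · refine Eventually.of_forall fun x => ?_
      have hcx : Continuous fun σ => ‖dilation σ g x - dilation τ g x‖ := by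
        by_cases hx : x ∈ Ici (1 : ℝ)
        · simp only [dilation, indicator_of_mem hx]
          fun_prop
        · simp only [dilation, indicator_of_notMem hx]
          fun_prop
      simpa using hcx.tendsto τ
  simpa using hlim

/-- Each `S_τ` is an `L¹` contraction, so approximating `f` by continuous compactly supported
functions is uniform in `τ`. -/
theorem continuous_dilationL1 (f : L1R) : Continuous fun τ => dilationL1 τ f := by
  refine continuous_of_uniform_approx_of_continuous fun u hu => ?_
  obtain ⟨ε, hε, hεu⟩ := Metric.mem_uniformity_dist.1 hu
  obtain ⟨g, hs, hfg, hc, hg⟩ :=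
    (L1.integrable_coeFn f).exists_hasCompactSupport_integral_sub_le (half_pos hε)
  refine ⟨_, continuous_dilationL1_toL1 hc hs hg, fun τ => hεu ?_⟩
  refine (dist_dilationL1_le τ f _).trans_lt (lt_of_le_of_lt ?_ (half_lt_self hε))
  refine le_trans (le_of_eq ?_) hfg
  conv_lhs => rw [← Integrable.toL1_coeFn f (L1.integrable_coeFn f)]
  exact dist_toL1_eq _ hg

theorem continuous_dilationL1_uncurry : Continuous fun q : ℝ × L1R => dilationL1 q.1 q.2 := by
  rw [continuous_iff_continuousAt]
  rintro ⟨τ, f⟩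
  refine tendsto_iff_dist_tendsto_zero.2 ?_
  have h1 : Tendsto (fun q : ℝ × L1R => dist q.2 f) (𝓝 (τ, f)) (𝓝 0) :=
    tendsto_iff_dist_tendsto_zero.1 (continuous_snd.tendsto (τ, f))
  have h2 : Tendsto (fun q : ℝ × L1R => dist (dilationL1 q.1 f) (dilationL1 τ f))
      (𝓝 (τ, f)) (𝓝 0) :=
    tendsto_iff_dist_tendsto_zero.1
      (((continuous_dilationL1 f).comp continuous_fst).tendsto (τ, f))
  refine squeeze_zero (fun _ => dist_nonneg) (fun q => ?_) (by simpa using h1.add h2)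
  exact (dist_triangle _ (dilationL1 q.1 f) _).trans
    (add_le_add_left (dist_dilationL1_le q.1 q.2 f) _)

/-! ### Truncated Fourier transforms, dilations and convolution powers. -/

/-- The Fourier transform truncated to the half line `(a, ∞)`. -/
def truncFourier (a : ℝ) (ζ : ℂ) (f : ℝ → ℝ) : ℂ :=
  ∫ x in Ioi a, Complex.exp (-Complex.I * ζ * x) * (f x : ℂ)

theorem norm_exp_neg_I_mul (ζ : ℂ) (x : ℝ) :
    ‖Complex.exp (-Complex.I * ζ * x)‖ = Real.exp (ζ.im * x) := by
  rw [Complex.norm_exp]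
  congr 1
  simp

theorem norm_exp_neg_I_mul_le {ζ : ℂ} (hζ : ζ.im ≤ 0) {x : ℝ} (hx : 0 ≤ x) :
    ‖Complex.exp (-Complex.I * ζ * x)‖ ≤ 1 := by
  rw [norm_exp_neg_I_mul]
  exact Real.exp_le_one_iff.2 (mul_nonpos_of_nonpos_of_nonneg hζ hx)

theorem continuous_exp_neg_I_mul (ζ : ℂ) :
    Continuous fun x : ℝ => Complex.exp (-Complex.I * ζ * x) := by fun_prop

theorem integrableOn_exp_mul {a : ℝ} (ha : 0 ≤ a) {ζ : ℂ} (hζ : ζ.im ≤ 0) {f : ℝ → ℝ}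
    (hf : Integrable f) :
    IntegrableOn (fun x : ℝ => Complex.exp (-Complex.I * ζ * x) * (f x : ℂ)) (Ioi a) := by
  refine Integrable.bdd_mul (c := 1) hf.ofReal.integrableOn
    (continuous_exp_neg_I_mul ζ).aestronglyMeasurable ?_
  filter_upwards [ae_restrict_mem measurableSet_Ioi] with x hx
  exact norm_exp_neg_I_mul_le hζ (ha.trans (le_of_lt hx))

theorem truncFourier_congr_ae (a : ℝ) (ζ : ℂ) {f g : ℝ → ℝ} (h : f =ᵐ[volume] g) :
    truncFourier a ζ f = truncFourier a ζ g := by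
  refine integral_congr_ae (ae_restrict_of_ae ?_)
  filter_upwards [h] with x hx
  rw [hx]

theorem norm_truncFourier_le {a : ℝ} (ha : 0 ≤ a) {ζ : ℂ} (hζ : ζ.im ≤ 0) {f : ℝ → ℝ}
    (hf : Integrable f) : ‖truncFourier a ζ f‖ ≤ ∫ x, ‖f x‖ := by
  refine (norm_integral_le_of_norm_le hf.norm.integrableOn ?_).trans
    (setIntegral_le_integral hf.norm (Eventually.of_forall fun x => norm_nonneg _))
  filter_upwards [ae_restrict_mem measurableSet_Ioi] with x hx
  rw [norm_mul, Complex.norm_real]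
  exact mul_le_of_le_one_left (norm_nonneg _)
    (norm_exp_neg_I_mul_le hζ (ha.trans (le_of_lt hx)))

/-- The truncated Fourier transform as a bounded functional on `L¹`. -/
def truncFourierCLM (a : ℝ) (ha : 0 ≤ a) (ζ : ℂ) (hζ : ζ.im ≤ 0) : L1R →L[ℝ] ℂ :=
  LinearMap.mkContinuous
    { toFun := fun f => truncFourier a ζ f
      map_add' := fun f g => by
        rw [truncFourier_congr_ae a ζ (Lp.coeFn_add f g), truncFourier, truncFourier,
          truncFourier, ← integral_add (integrableOn_exp_mul ha hζ (L1.integrable_coeFn f))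
            (integrableOn_exp_mul ha hζ (L1.integrable_coeFn g))]
        congr 1 with x
        simp [mul_add]
      map_smul' := fun c f => by
        rw [truncFourier_congr_ae a ζ (Lp.coeFn_smul c f), truncFourier, truncFourier,
          ← integral_smul]
        congr 1 with x
        simp [mul_left_comm] }
    1 fun f => by
      rw [one_mul, L1.norm_eq_integral_norm]
      exact norm_truncFourier_le ha hζ (L1.integrable_coeFn f)

theorem truncFourierCLM_apply (a : ℝ) (ha : 0 ≤ a) (ζ : ℂ) (hζ : ζ.im ≤ 0) (f : L1R) :
    truncFourierCLM a ha ζ hζ f = truncFourier a ζ f := rfl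

/-- Linear substitution; since `a ≥ 1`, the cut-off at `1` in `dilation` is invisible on `(a,∞)`. -/
theorem truncFourier_dilation {a : ℝ} (ha : 1 ≤ a) (ζ : ℂ) (σ : ℝ) (f : ℝ → ℝ) :
    truncFourier a ζ (dilation σ f)
      = truncFourier (Real.exp σ * a) (Real.exp (-σ) * ζ) f := by
  have h := integral_comp_mul_left_Ioi (fun x : ℝ =>
    Complex.exp (-Complex.I * (Real.exp (-σ) * ζ) * x) * (f x : ℂ)) a (Real.exp_pos σ)
  rw [truncFourier, truncFourier, ← inv_smul_eq_iff₀ (inv_ne_zero (Real.exp_ne_zero σ)) |>.2 h,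
    inv_inv, ← integral_smul]
  refine setIntegral_congr_fun measurableSet_Ioi fun x hx => ?_
  have hx1 : x ∈ Ici (1 : ℝ) := ha.trans (le_of_lt hx)
  have he : (Real.exp (-σ) : ℂ) * (Real.exp σ : ℂ) = 1 := by
    rw [← Complex.ofReal_mul, ← Real.exp_add]; simp
  have h2 : -Complex.I * (Real.exp (-σ) * ζ) * ((Real.exp σ * x : ℝ) : ℂ)
      = -Complex.I * ζ * x := by
    rw [Complex.ofReal_mul]
    linear_combination (-Complex.I * ζ * x) * he
  simp only [dilation, indicator_of_mem hx1, h2, Complex.real_smul]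
  push_cast
  ring

theorem truncFourier_eq_integral {a b : ℝ} (hab : a ≤ b) (ζ : ℂ) {f : ℝ → ℝ}
    (hf : ∀ᵐ x, x < b → f x = 0) :
    truncFourier a ζ f = ∫ x : ℝ, Complex.exp (-Complex.I * ζ * x) * (f x : ℂ) := by
  refine setIntegral_eq_integral_of_ae_compl_eq_zero ?_
  filter_upwards [hf, compl_mem_ae_iff.2 (measure_singleton b)] with x hx hxb hxa
  have : x < b := lt_of_le_of_ne ((not_lt.1 hxa).trans hab) hxb
  simp [hx this]

theorem integrable_exp_mul_of_ae_zero {ζ : ℂ} (hζ : ζ.im ≤ 0) {f : ℝ → ℝ}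
    (hf : Integrable f) (hf0 : ∀ᵐ x, x < 1 → f x = 0) :
    Integrable fun x : ℝ => Complex.exp (-Complex.I * ζ * x) * (f x : ℂ) := by
  have h := (integrableOn_exp_mul zero_le_one hζ hf).integrable_indicator measurableSet_Ioi
  refine h.congr ?_
  filter_upwards [hf0, compl_mem_ae_iff.2 (measure_singleton (1 : ℝ))] with x hx hx1
  by_cases hxm : x ∈ Ioi (1 : ℝ)
  · rw [indicator_of_mem hxm]
  · rw [indicator_of_notMem hxm, hx (lt_of_le_of_ne (not_lt.1 hxm) hx1)]
    simp

/-- The exponential is multiplicative, so weighting by it commutes with convolution; transforms of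
convolution powers thereby become plain integrals of convolutions. -/
theorem convolution_exp_mul (ζ : ℂ) (f g : ℝ → ℝ) (x : ℝ) :
    convolution (fun x : ℝ => Complex.exp (-Complex.I * ζ * x) * (f x : ℂ))
        (fun x : ℝ => Complex.exp (-Complex.I * ζ * x) * (g x : ℂ))
        (ContinuousLinearMap.mul ℝ ℂ) volume x
      = Complex.exp (-Complex.I * ζ * x)
        * ((convolution f g (ContinuousLinearMap.mul ℝ ℝ) volume x : ℝ) : ℂ) := by
  simp only [convolution, ContinuousLinearMap.mul_apply']
  rw [← integral_complex_ofReal, ← integral_const_mul]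
  congr 1 with t
  have : Complex.exp (-Complex.I * ζ * x)
      = Complex.exp (-Complex.I * ζ * t) * Complex.exp (-Complex.I * ζ * ((x - t : ℝ) : ℂ)) := by
    rw [← Complex.exp_add]
    congr 1
    push_cast
    ring
  rw [this]
  push_cast
  ring

theorem integral_exp_mul_convPow {ζ : ℂ} {f : ℝ → ℝ}
    (h : Integrable fun x : ℝ => Complex.exp (-Complex.I * ζ * x) * (f x : ℂ)) :
    ∀ j : ℕ, Integrable (fun x : ℝ =>
        Complex.exp (-Complex.I * ζ * x) * (convPow f (j + 1) x : ℂ)) ∧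
      ∫ x : ℝ, Complex.exp (-Complex.I * ζ * x) * (convPow f (j + 1) x : ℂ)
        = (∫ x : ℝ, Complex.exp (-Complex.I * ζ * x) * (f x : ℂ)) ^ (j + 1)
  | 0 => ⟨h, by simp [convPow]⟩
  | j + 1 => by
    obtain ⟨ih1, ih2⟩ := integral_exp_mul_convPow h j
    have h1 := h.integrable_convolution (ContinuousLinearMap.mul ℝ ℂ) ih1
    have h2 := integral_convolution (ContinuousLinearMap.mul ℝ ℂ) h ih1
    have h3 : convolution (fun x : ℝ => Complex.exp (-Complex.I * ζ * x) * (f x : ℂ))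
        (fun x : ℝ => Complex.exp (-Complex.I * ζ * x) * (convPow f (j + 1) x : ℂ))
        (ContinuousLinearMap.mul ℝ ℂ) volume
        = fun x : ℝ => Complex.exp (-Complex.I * ζ * x) * (convPow f (j + 1 + 1) x : ℂ) :=
      funext fun x => convolution_exp_mul ζ f (convPow f (j + 1)) x
    rw [h3] at h1 h2
    refine ⟨h1, ?_⟩
    rw [h2, ih2, ContinuousLinearMap.mul_apply']
    exact (pow_succ' _ _).symm

theorem integral_exp_mul_Qconv (N : ℕ) (p : ℕ → ℝ) {ζ : ℂ} {f : ℝ → ℝ}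
    (h : Integrable fun x : ℝ => Complex.exp (-Complex.I * ζ * x) * (f x : ℂ)) :
    ∫ x : ℝ, Complex.exp (-Complex.I * ζ * x) * (Qconv N p f x : ℂ)
      = Qpoly N p (∫ x : ℝ, Complex.exp (-Complex.I * ζ * x) * (f x : ℂ)) := by
  have hj : ∀ j ∈ Finset.Icc 1 N, Integrable (fun x : ℝ =>
        Complex.exp (-Complex.I * ζ * x) * (convPow f j x : ℂ)) ∧
      ∫ x : ℝ, Complex.exp (-Complex.I * ζ * x) * (convPow f j x : ℂ)
        = (∫ x : ℝ, Complex.exp (-Complex.I * ζ * x) * (f x : ℂ)) ^ j := by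
    intro j hj
    obtain ⟨k, rfl⟩ := Nat.exists_eq_add_of_le' (Finset.mem_Icc.1 hj).1
    exact integral_exp_mul_convPow h k
  have hsum : ∀ x : ℝ, Complex.exp (-Complex.I * ζ * x) * (Qconv N p f x : ℂ)
      = ∑ j ∈ Finset.Icc 1 N,
        (p j : ℂ) * (Complex.exp (-Complex.I * ζ * x) * (convPow f j x : ℂ)) := by
    intro x
    rw [Qconv, Complex.ofReal_sum, Finset.mul_sum]
    refine Finset.sum_congr rfl fun j _ => ?_
    push_cast
    ring
  simp_rw [hsum]
  rw [integral_finsetSum _ fun j hjm => (hj j hjm).1.const_mul _, Qpoly]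
  refine Finset.sum_congr rfl fun j hjm => ?_
  rw [integral_const_mul, (hj j hjm).2]

theorem convPow_ae_zero {f : ℝ → ℝ} (hf : ∀ᵐ x, x < 1 → f x = 0) :
    ∀ j : ℕ, ∀ᵐ x, x < 1 → convPow f j x = 0
  | 0 => by simp [convPow]
  | 1 => hf
  | j + 2 => by
    have ih := convPow_ae_zero hf (j + 1)
    refine Eventually.of_forall fun x hx => ?_
    have h2 : ∀ᵐ t, x - t < 1 → convPow f (j + 1) (x - t) = 0 :=
      (quasiMeasurePreserving_sub_left volume x).ae ih
    simp only [convPow, convolution, ContinuousLinearMap.mul_apply']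
    refine integral_eq_zero_of_ae ?_
    filter_upwards [hf, h2] with t ht1 ht2
    rcases lt_or_ge t 1 with h | h
    · simp [ht1 h]
    · simp [ht2 (by linarith)]

theorem Qconv_ae_zero (N : ℕ) (p : ℕ → ℝ) {f : ℝ → ℝ} (hf : ∀ᵐ x, x < 1 → f x = 0) :
    ∀ᵐ x, x < 1 → Qconv N p f x = 0 := by
  filter_upwards [ae_all_iff.2 (convPow_ae_zero hf)] with x hx hx1
  exact Finset.sum_eq_zero fun j _ => by rw [hx j hx1, mul_zero]

/-- `T₁ ℚ[f]` lives on `[2,∞)`, so truncating at `a ≤ 2` loses nothing. The unit shift yields the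
exponential factor. -/
theorem truncFourier_shiftOne_Qconv (N : ℕ) (p : ℕ → ℝ) {a : ℝ} (ha : a ≤ 2) {ζ : ℂ}
    (hζ : ζ.im ≤ 0) {f : ℝ → ℝ} (hf : Integrable f) (hf0 : ∀ᵐ x, x < 1 → f x = 0) :
    truncFourier a ζ (shiftOne (Qconv N p f))
      = Complex.exp (-Complex.I * ζ) * Qpoly N p (fourier f ζ) := by
  have hQ : ∀ᵐ x : ℝ, x - 1 < 1 → Qconv N p f (x - 1) = 0 :=
    (measurePreserving_sub_right volume (1 : ℝ)).quasiMeasurePreserving.ae (Qconv_ae_zero N p hf0)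
  have hshift : shiftOne (Qconv N p f) =ᵐ[volume] fun x => Qconv N p f (x - 1) := by
    filter_upwards [hQ] with x hx
    by_cases hx2 : x ∈ Ici (2 : ℝ)
    · simp [shiftOne, indicator_of_mem hx2]
    · rw [shiftOne, indicator_of_notMem hx2, hx]
      have : x < 2 := not_le.1 hx2
      linarith
  have hfour : fourier f ζ = ∫ x : ℝ, Complex.exp (-Complex.I * ζ * x) * (f x : ℂ) :=
    truncFourier_eq_integral le_rfl ζ hf0
  rw [truncFourier_congr_ae a ζ hshift, truncFourier_eq_integral (b := 2) ha ζ, hfour,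
    ← integral_exp_mul_Qconv N p (integrable_exp_mul_of_ae_zero hζ hf hf0),
    ← integral_const_mul, ← integral_sub_right_eq_self (fun x : ℝ => Complex.exp (-Complex.I * ζ)
      * (Complex.exp (-Complex.I * ζ * x) * (Qconv N p f x : ℂ))) (1 : ℝ)]
  · congr 1 with x
    rw [← mul_assoc, ← Complex.exp_add]
    congr 2
    push_cast
    ring
  · filter_upwards [hQ] with x hx hx2 using hx (by linarith)

/-! ### The trace and the substitution `y = e^{s-τ}`. -/

/-- Transfers almost-everywhere statements on `η(τ)` to the trace. Preimages of null sets are null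
because they are images under the differentiable function `log`. -/
theorem quasiMeasurePreserving_exp_sub (τ : ℝ) :
    Measure.QuasiMeasurePreserving (fun s : ℝ => Real.exp (s - τ)) volume volume := by
  have hexp : Measure.QuasiMeasurePreserving Real.exp volume volume := by
    refine ⟨Real.measurable_exp, Measure.AbsolutelyContinuous.mk fun s hs h0 => ?_⟩
    rw [Measure.map_apply Real.measurable_exp hs]
    have himg : Real.log '' (s ∩ Ioi 0) = Real.exp ⁻¹' s := by
      ext x
      constructor
      · rintro ⟨y, ⟨hy, hy0⟩, rfl⟩
        rwa [mem_preimage, Real.exp_log hy0]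
      · exact fun hx => ⟨Real.exp x, ⟨hx, Real.exp_pos x⟩, Real.log_exp x⟩
    rw [← himg]
    refine addHaar_image_eq_zero_of_differentiableOn_of_addHaar_eq_zero volume (fun x hx => ?_)
      (measure_mono_null inter_subset_left h0)
    exact (Real.differentiableAt_log (ne_of_gt hx.2)).differentiableWithinAt
  exact hexp.comp (measurePreserving_sub_right volume τ).quasiMeasurePreserving

theorem hasDerivAt_exp_sub (τ s : ℝ) :
    HasDerivAt (fun s : ℝ => Real.exp (s - τ)) (Real.exp (s - τ)) s := by
  simpa using ((hasDerivAt_id s).sub_const τ).exp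

theorem injective_exp_sub (τ : ℝ) : Function.Injective fun s : ℝ => Real.exp (s - τ) :=
  fun a b h => by simpa using h

theorem image_exp_sub_Ioc (τ a b : ℝ) :
    (fun s : ℝ => Real.exp (s - τ)) '' Ioc a b = Ioc (Real.exp (a - τ)) (Real.exp (b - τ)) := by
  ext x
  constructor
  · rintro ⟨s, hs, rfl⟩
    exact ⟨Real.exp_lt_exp.2 (by linarith [hs.1]), Real.exp_le_exp.2 (by linarith [hs.2])⟩
  · intro hx
    have hx0 : 0 < x := (Real.exp_pos _).trans hx.1
    refine ⟨Real.log x + τ, ⟨?_, ?_⟩, by simp [Real.exp_log hx0]⟩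
    · linarith [(Real.lt_log_iff_exp_lt hx0).2 hx.1]
    · linarith [(Real.log_le_iff_le_exp hx0).2 hx.2]

theorem image_exp_Ioi (a : ℝ) : Real.exp '' Ioi a = Ioi (Real.exp a) := by
  ext x
  constructor
  · rintro ⟨s, hs, rfl⟩
    exact Real.exp_lt_exp.2 hs
  · intro hx
    have hx0 : 0 < x := (Real.exp_pos _).trans hx
    exact ⟨Real.log x, (Real.lt_log_iff_exp_lt hx0).2 hx, Real.exp_log hx0⟩

theorem IsTrace.integrableOn_Ioc {η : ℝ → L1R} {β : ℝ → ℝ} (h : IsTrace η β) {τ : ℝ}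
    (hτ : 0 ≤ τ) : IntegrableOn β (Ioc τ (τ + Real.log 2)) := by
  have h1 : IntegrableOn (η τ) ((fun s : ℝ => Real.exp (s - τ)) '' Ioc τ (τ + Real.log 2)) :=
    (L1.integrable_coeFn (η τ)).integrableOn
  rw [integrableOn_image_iff_integrableOn_abs_deriv_smul measurableSet_Ioc
    (fun s _ => (hasDerivAt_exp_sub τ s).hasDerivWithinAt) (injective_exp_sub τ).injOn] at h1
  refine h1.congr ?_
  filter_upwards [ae_restrict_mem measurableSet_Ioc, ae_restrict_of_ae (h τ hτ)] with s hs hβ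
  rw [hβ (Ioc_subset_Icc_self hs), Real.abs_exp, smul_eq_mul]

theorem IsTrace.intervalIntegrable {η : ℝ → L1R} {β : ℝ → ℝ} (h : IsTrace η β) {a b : ℝ}
    (ha : 0 ≤ a) (hb : 0 ≤ b) : IntervalIntegrable β volume a b := by
  have h2 : 0 < Real.log 2 := Real.log_pos one_lt_two
  have hn : ∀ n : ℕ, IntervalIntegrable β volume 0 (n * Real.log 2) := by
    intro n
    induction n with
    | zero => simp
    | succ n ih =>
      refine ih.trans ?_
      have hle : n * Real.log 2 ≤ (n + 1 : ℕ) * Real.log 2 := by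
        push_cast; nlinarith
      rw [intervalIntegrable_iff_integrableOn_Ioc_of_le hle]
      have he : (n + 1 : ℕ) * Real.log 2 = n * Real.log 2 + Real.log 2 := by push_cast; ring
      rw [he]
      exact h.integrableOn_Ioc (by positivity)
  have hc : ∀ c, 0 ≤ c → IntervalIntegrable β volume 0 c := by
    intro c hc
    obtain ⟨n, hcn⟩ := exists_nat_ge (c / Real.log 2)
    rw [div_le_iff₀ h2] at hcn
    refine (hn n).mono_set ?_
    rw [uIcc_of_le hc, uIcc_of_le (hc.trans hcn)]
    exact Icc_subset_Icc_right hcn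
  exact (hc a ha).symm.trans (hc b hb)

theorem IsTrace.ae_nonneg {η : ℝ → L1R} {β : ℝ → ℝ} (h : IsTrace η β)
    (hη : ∀ τ, 0 ≤ τ → η τ ∈ probDensities) : ∀ᵐ s, 0 ≤ s → 0 ≤ β s := by
  have h2 : 0 < Real.log 2 := Real.log_pos one_lt_two
  have hn : ∀ n : ℕ, ∀ᵐ s, s ∈ Icc (n * Real.log 2) (n * Real.log 2 + Real.log 2) → 0 ≤ β s := by
    intro n
    have h0 : 0 ≤ n * Real.log 2 := by positivity
    filter_upwards [h _ h0, (quasiMeasurePreserving_exp_sub (n * Real.log 2)).ae (hη _ h0).2.1]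
      with s hs1 hs2 hs
    rw [hs1 hs]
    exact mul_nonneg (Real.exp_pos _).le hs2
  filter_upwards [ae_all_iff.2 hn] with s hs hs0
  refine hs ⌊s / Real.log 2⌋₊ ⟨?_, ?_⟩
  · exact (le_div_iff₀ h2).1 (Nat.floor_le (by positivity))
  · have := (div_lt_iff₀ h2).1 (Nat.lt_floor_add_one (s / Real.log 2))
    linarith

/-- The part of `η(τ)` on `(1, e^{t-τ}]` is what leaves through the boundary `1` during `[τ, t]`;
the substitution `y = e^{s-τ}` expresses it through `β`. -/
theorem IsTrace.truncFourier_sub {η : ℝ → L1R} {β : ℝ → ℝ} (h : IsTrace η β) {τ t : ℝ}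
    (hτ : 0 ≤ τ) (hτt : τ ≤ t) (ht : t ≤ τ + Real.log 2) {ξ : ℂ} (hξ : ξ.im ≤ 0) :
    truncFourier 1 (Real.exp τ * ξ) (η τ) - truncFourier (Real.exp (t - τ)) (Real.exp τ * ξ) (η τ)
      = ∫ s in τ..t, (β s : ℂ) * Complex.exp (-Complex.I * (Real.exp s * ξ)) := by
  have him : ((Real.exp τ : ℂ) * ξ).im ≤ 0 := by
    rw [Complex.im_ofReal_mul]
    exact mul_nonpos_of_nonneg_of_nonpos (Real.exp_pos τ).le hξ
  have h1 : (1 : ℝ) ≤ Real.exp (t - τ) := Real.one_le_exp (by linarith)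
  have hint := integrableOn_exp_mul zero_le_one him (L1.integrable_coeFn (η τ))
  have hunion := setIntegral_union (Ioc_disjoint_Ioi le_rfl) measurableSet_Ioi
    (hint.mono_set (Ioc_subset_Ioi_self : Ioc 1 (Real.exp (t - τ)) ⊆ Ioi 1))
    (hint.mono_set (Ioi_subset_Ioi h1))
  rw [Ioc_union_Ioi_eq_Ioi h1] at hunion
  rw [truncFourier, truncFourier, hunion, add_sub_cancel_right,
    intervalIntegral.integral_of_le hτt]
  have himg := image_exp_sub_Ioc τ τ t
  rw [sub_self, Real.exp_zero] at himg
  rw [← himg, integral_image_eq_integral_abs_deriv_smul measurableSet_Ioc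
    (fun s _ => (hasDerivAt_exp_sub τ s).hasDerivWithinAt) (injective_exp_sub τ).injOn]
  refine setIntegral_congr_ae measurableSet_Ioc ?_
  filter_upwards [h τ hτ] with s hs hsm
  rw [hs ⟨hsm.1.le, hsm.2.trans ht⟩, Real.abs_exp, Complex.real_smul]
  have he : -Complex.I * (Real.exp τ * ξ) * (Real.exp (s - τ) : ℝ)
      = -Complex.I * (Real.exp s * ξ) := by
    have : (Real.exp τ : ℂ) * (Real.exp (s - τ) : ℂ) = Real.exp s := by
      rw [← Complex.ofReal_mul, ← Real.exp_add, add_sub_cancel]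
    linear_combination (-Complex.I * ξ) * this
  rw [he, Complex.ofReal_mul]
  ring

/-- Cut-off `e^{c-s}` and frequency `e^s ξ` move together under dilation, so for fixed `c` the right
side no longer depends on `τ`. -/
theorem truncFourier_dilation_exp {c τ : ℝ} (hc : τ ≤ c) (s : ℝ) (ξ : ℂ) (f : ℝ → ℝ) :
    truncFourier (Real.exp (c - τ)) (Real.exp τ * ξ) (dilation (τ - s) f)
      = truncFourier (Real.exp (c - s)) (Real.exp s * ξ) f := by
  rw [truncFourier_dilation (Real.one_le_exp (by linarith)), ← Real.exp_add]
  congr 1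
  · ring_nf
  · rw [← mul_assoc, ← Complex.ofReal_mul, ← Real.exp_add]
    ring_nf

/-! ### The equation along characteristics. -/

section Solution

variable {N : ℕ} {p : ℕ → ℝ} {η₀ : L1R} {η : ℝ → L1R} {β : ℝ → ℝ}

theorem IsSolution.intervalIntegrable_dilationL1 (hη : IsSolution N p η₀ η)
    (hβ : IsTrace η β) {τ : ℝ} (hτ : 0 ≤ τ) :
    IntervalIntegrable (fun s => β s • dilationL1 (τ - s) (shiftQconvL1 N p (η s)))
      volume 0 τ := by
  refine (hβ.intervalIntegrable le_rfl hτ).smul_continuousOn ?_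
  rw [uIcc_of_le hτ]
  have h1 : ContinuousOn (fun s => shiftQconvL1 N p (η s)) (Icc 0 τ) :=
    (continuous_shiftQconvL1 N p).comp_continuousOn
      (hη.continuousOn.mono fun s hs => hs.1)
  exact continuous_dilationL1_uncurry.comp_continuousOn
    ((continuousOn_const.sub continuousOn_id).prodMk h1)

/-- The integrated equation, tested against exponentials on a half line. -/
theorem IsSolution.truncFourier_eq (hη : IsSolution N p η₀ η) (hβ : IsTrace η β)
    (heq : ∀ τ : ℝ, 0 ≤ τ → η τ = dilationL1 τ η₀
      + ∫ s in (0 : ℝ)..τ, β s • dilationL1 (τ - s) (shiftQconvL1 N p (η s)))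
    {τ c : ℝ} (hτ : 0 ≤ τ) (hc : τ ≤ c) {ξ : ℂ} (hξ : ξ.im ≤ 0) :
    IntervalIntegrable (fun s => (β s : ℂ) * truncFourier (Real.exp (c - s)) (Real.exp s * ξ)
        (shiftQconvL1 N p (η s))) volume 0 τ ∧
      truncFourier (Real.exp (c - τ)) (Real.exp τ * ξ) (η τ)
        = truncFourier (Real.exp c) ξ η₀ + ∫ s in (0 : ℝ)..τ,
          (β s : ℂ) * truncFourier (Real.exp (c - s)) (Real.exp s * ξ)
            (shiftQconvL1 N p (η s)) := by
  have him : ((Real.exp τ : ℂ) * ξ).im ≤ 0 := by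
    rw [Complex.im_ofReal_mul]
    exact mul_nonpos_of_nonneg_of_nonpos (Real.exp_pos τ).le hξ
  set Λ := truncFourierCLM (Real.exp (c - τ)) (Real.exp_pos _).le _ him with hΛ
  have hint := hη.intervalIntegrable_dilationL1 hβ hτ
  have hdil : ∀ (s : ℝ) (f : L1R), Λ (dilationL1 (τ - s) f)
      = truncFourier (Real.exp (c - s)) (Real.exp s * ξ) f := by
    intro s f
    rw [hΛ, truncFourierCLM_apply, dilationL1,
      truncFourier_congr_ae _ _ (integrable_dilation (τ - s) (L1.integrable_coeFn f)).coeFn_toL1,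
      truncFourier_dilation_exp hc]
  have hfun : ∀ s, Λ (β s • dilationL1 (τ - s) (shiftQconvL1 N p (η s)))
      = (β s : ℂ) * truncFourier (Real.exp (c - s)) (Real.exp s * ξ)
        (shiftQconvL1 N p (η s)) := by
    intro s
    rw [map_smul, hdil, Complex.real_smul]
  constructor
  · have h1 : IntervalIntegrable
        (fun s => Λ (β s • dilationL1 (τ - s) (shiftQconvL1 N p (η s)))) volume 0 τ :=
      ⟨Λ.integrable_comp hint.1, Λ.integrable_comp hint.2⟩
    simpa only [hfun] using h1
  · have h2 := congrArg Λ (heq τ hτ)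
    rw [map_add, ← Λ.intervalIntegral_comp_comm hint] at h2
    simp only [hfun] at h2
    have h3 := hdil 0 η₀
    simp only [sub_zero, Real.exp_zero, Complex.ofReal_one, one_mul] at h3
    rw [h3] at h2
    exact h2

/-- Along the characteristics `τ ↦ e^τ ξ`, the Fourier transform of a solution satisfies an
ordinary differential equation in integrated form. -/
theorem IsSolution.fourier_sub_eq (hη : IsSolution N p η₀ η) (hβ : IsTrace η β)
    (heq : ∀ τ : ℝ, 0 ≤ τ → η τ = dilationL1 τ η₀
      + ∫ s in (0 : ℝ)..τ, β s • dilationL1 (τ - s) (shiftQconvL1 N p (η s)))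
    {τ t : ℝ} (hτ : 0 ≤ τ) (hτt : τ ≤ t) (ht : t ≤ τ + Real.log 2) {ξ : ℂ} (hξ : ξ.im ≤ 0) :
    fourier (η t) (Real.exp t * ξ) - fourier (η τ) (Real.exp τ * ξ)
      = -∫ s in τ..t, (β s : ℂ) * Complex.exp (-Complex.I * (Real.exp s * ξ))
        * (1 - Qpoly N p (fourier (η s) (Real.exp s * ξ))) := by
  have ht0 : 0 ≤ t := hτ.trans hτt
  -- Both times use the parameter `c = t`, so the initial terms and the integrands agree and cancel
  -- on `[0, τ]`. The cut-offs are then `1` at time `t` and `e^{t-τ}` at time `τ`.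
  obtain ⟨hi1, he1⟩ := hη.truncFourier_eq hβ heq ht0 le_rfl hξ
  obtain ⟨hi2, he2⟩ := hη.truncFourier_eq hβ heq hτ hτt hξ
  have htr := hβ.truncFourier_sub hτ hτt ht hξ
  have hdiff := intervalIntegral.integral_interval_sub_left hi1 hi2
  rw [sub_self, Real.exp_zero] at he1
  have hi3 : IntervalIntegrable (fun s => (β s : ℂ) * truncFourier (Real.exp (t - s))
      (Real.exp s * ξ) (shiftQconvL1 N p (η s))) volume τ t := hi2.symm.trans hi1
  have hbe : IntervalIntegrable (fun s => (β s : ℂ) * Complex.exp (-Complex.I * (Real.exp s * ξ)))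
      volume τ t := by
    have hb : IntervalIntegrable (fun s => (β s : ℂ)) volume τ t :=
      let h := hβ.intervalIntegrable hτ ht0
      ⟨h.1.ofReal, h.2.ofReal⟩
    exact hb.mul_continuousOn (by fun_prop)
  have hval : ∀ s ∈ Icc τ t, truncFourier (Real.exp (t - s)) (Real.exp s * ξ)
      (shiftQconvL1 N p (η s)) = Complex.exp (-Complex.I * (Real.exp s * ξ))
        * Qpoly N p (fourier (η s) (Real.exp s * ξ)) := by
    intro s hs
    have him : ((Real.exp s : ℂ) * ξ).im ≤ 0 := by
      rw [Complex.im_ofReal_mul]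
      exact mul_nonpos_of_nonneg_of_nonpos (Real.exp_pos s).le hξ
    -- The window length `log 2` keeps the cut-off below the support `[2,∞)` of `T₁ ℚ[η(s)]`.
    have hle : Real.exp (t - s) ≤ 2 := by
      rw [← Real.exp_log (zero_lt_two : (0 : ℝ) < 2)]
      exact Real.exp_le_exp.2 (by linarith [hs.1])
    rw [shiftQconvL1, truncFourier_congr_ae _ _ (Integrable.coeFn_toL1 _)]
    exact truncFourier_shiftOne_Qconv N p hle him (L1.integrable_coeFn _)
      (hη.mem s (hτ.trans hs.1)).1
  have hmain : ∫ s in τ..t, (β s : ℂ) * Complex.exp (-Complex.I * (Real.exp s * ξ))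
        * (1 - Qpoly N p (fourier (η s) (Real.exp s * ξ)))
      = (∫ s in τ..t, (β s : ℂ) * Complex.exp (-Complex.I * (Real.exp s * ξ)))
        - ∫ s in τ..t, (β s : ℂ) * truncFourier (Real.exp (t - s)) (Real.exp s * ξ)
          (shiftQconvL1 N p (η s)) := by
    rw [← intervalIntegral.integral_sub hbe hi3]
    refine intervalIntegral.integral_congr fun s hs => ?_
    rw [uIcc_of_le hτt] at hs
    simp only [hval s hs]
    ring
  rw [hmain, ← htr, ← hdiff]
  change truncFourier 1 _ _ - truncFourier 1 _ _ = _
  rw [he1, he2]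
  ring

end Solution

/-! ### Uniqueness of the inverse Fourier transform. -/

/-- An integrable function on the line is determined by its Fourier transform. -/
theorem ae_eq_of_integral_cexp_eq {f g : ℝ → ℝ} (hf : Integrable f) (hg : Integrable g)
    (h : ∀ t : ℝ, ∫ x : ℝ, Complex.exp (t * x * Complex.I) * (f x : ℂ)
      = ∫ x : ℝ, Complex.exp (t * x * Complex.I) * (g x : ℂ)) : f =ᵐ[volume] g := by
  have hd : Integrable fun x => f x - g x := hf.sub hg
  have hdn : Integrable fun x => -(f x - g x) := hd.neg
  -- The positive and negative parts of `f - g` are densities of finite measures with equal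
  -- characteristic functions, hence coincide; a number whose two parts are equal is `0`.
  have hm : AEMeasurable fun x => ENNReal.ofReal (f x - g x) :=
    hd.aestronglyMeasurable.aemeasurable.ennreal_ofReal
  have hmn : AEMeasurable fun x => ENNReal.ofReal (-(f x - g x)) :=
    hdn.aestronglyMeasurable.aemeasurable.ennreal_ofReal
  have := isFiniteMeasure_withDensity_ofReal hd.2
  have := isFiniteMeasure_withDensity_ofReal hdn.2
  have hbd : ∀ (t : ℝ) {k : ℝ → ℝ}, Integrable k →
      Integrable fun x : ℝ => Complex.exp (t * x * Complex.I) * (k x : ℂ) := by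
    intro t k hk
    refine Integrable.bdd_mul (c := 1) hk.ofReal (by fun_prop) (Eventually.of_forall fun x => ?_)
    rw [← Complex.ofReal_mul, Complex.norm_exp_ofReal_mul_I]
  have hchar : charFun (volume.withDensity fun x => ENNReal.ofReal (f x - g x))
      = charFun (volume.withDensity fun x => ENNReal.ofReal (-(f x - g x))) := by
    ext t
    rw [charFun_apply_real, charFun_apply_real,
      integral_withDensity_eq_integral_toReal_smul₀ hm (Eventually.of_forall fun _ => by simp),
      integral_withDensity_eq_integral_toReal_smul₀ hmn (Eventually.of_forall fun _ => by simp),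
      ← sub_eq_zero, ← integral_sub]
    · have h2 : ∫ x : ℝ, Complex.exp (t * x * Complex.I) * ((f x - g x : ℝ) : ℂ) = 0 := by
        simp only [Complex.ofReal_sub, mul_sub]
        rw [integral_sub (hbd t hf) (hbd t hg), h t, sub_self]
      rw [← h2]
      congr 1 with x
      rw [ENNReal.toReal_ofReal', ENNReal.toReal_ofReal', ← sub_smul, Complex.real_smul,
        max_comm, max_comm (-_) (0 : ℝ), mul_comm]
      congr 2
      rcases le_total 0 (f x - g x) with h0 | h0
      · rw [max_eq_right h0, max_eq_left (by linarith), sub_zero]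
      · rw [max_eq_left h0, max_eq_right (by linarith)]; ring
    · refine (hbd t hd.pos_part).congr (Eventually.of_forall fun x => ?_)
      simp only [ENNReal.toReal_ofReal', Complex.real_smul]
      rw [mul_comm]
    · refine (hbd t hdn.pos_part).congr (Eventually.of_forall fun x => ?_)
      simp only [ENNReal.toReal_ofReal', Complex.real_smul]
      rw [mul_comm]
  have hμ := Measure.ext_of_charFun hchar
  rw [withDensity_eq_iff_of_sigmaFinite hm hmn] at hμ
  filter_upwards [hμ] with x hx
  have hx' := congrArg ENNReal.toReal hx
  rw [ENNReal.toReal_ofReal', ENNReal.toReal_ofReal'] at hx'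
  rcases le_total 0 (f x - g x) with h0 | h0
  · rw [max_eq_left h0, max_eq_right (by linarith)] at hx'
    linarith
  · rw [max_eq_right h0, max_eq_left (by linarith)] at hx'
    linarith

/-- The line `Im ξ = -1` suffices: there the transform of `w` is the classical one of the integrable
function `e^{-x} w(x)`. -/
theorem HasFourier.ae_eq {w v : ℝ → ℝ} {g : ℂ → ℂ} (hw : HasFourier w g)
    (hv : HasFourier v g) : w =ᵐ[volume] v := by
  have hint : ∀ {u : ℝ → ℝ}, HasFourier u g →
      Integrable ((Ioi (1 : ℝ)).indicator fun x => Real.exp (-1 * x) * u x) := fun hu =>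
    (integrable_indicator_iff measurableSet_Ioi).2 (hu.integrable_exp 1 one_pos)
  have hval : ∀ {u : ℝ → ℝ}, HasFourier u g → ∀ t : ℝ,
      ∫ x : ℝ, Complex.exp (t * x * Complex.I)
        * ((Ioi (1 : ℝ)).indicator (fun x => Real.exp (-1 * x) * u x) x : ℝ)
      = g (-t - Complex.I) := by
    intro u hu t
    rw [← hu.fourier_eq _ (by simp), fourier, ← integral_indicator measurableSet_Ioi]
    congr 1 with x
    by_cases hx : x ∈ Ioi (1 : ℝ)
    · simp only [indicator_of_mem hx, Complex.ofReal_mul, Complex.ofReal_exp]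
      rw [← mul_assoc, ← Complex.exp_add]
      congr 2
      push_cast
      linear_combination (-x : ℂ) * Complex.I_mul_I
    · simp [indicator_of_notMem hx]
  have h := ae_eq_of_integral_cexp_eq (hint hw) (hint hv) fun t => by
    rw [hval hw t, hval hv t]
  filter_upwards [h, compl_mem_ae_iff.2 (measure_singleton (1 : ℝ))] with x hx hx1
  rcases lt_or_ge 1 x with hlt | hle
  · rw [indicator_of_mem (mem_Ioi.2 hlt), indicator_of_mem (mem_Ioi.2 hlt)] at hx
    exact mul_left_cancel₀ (Real.exp_ne_zero _) hx
  · have : x < 1 := lt_of_le_of_ne hle hx1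
    rw [hw.eq_zero x this, hv.eq_zero x this]

theorem hasFourier_fourierInv {w : ℝ → ℝ} {g : ℂ → ℂ} (h : HasFourier w g) :
    HasFourier (fourierInv g) g := by
  have hex : ∃ w, HasFourier w g := ⟨w, h⟩
  rw [fourierInv, dif_pos hex]
  exact hex.choose_spec

/-! ### Decay at infinite time and the profile of the trace. -/

/-- Since `x > 1` on the support, `|e^{-iζx}| ≤ e^{Im ζ}`. This keeps the characteristic curves in
the open unit disk and drives them to `0`. -/
theorem norm_fourier_le_exp {f : L1R} (hf : f ∈ probDensities) {ζ : ℂ} (hζ : ζ.im ≤ 0) :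
    ‖fourier f ζ‖ ≤ Real.exp ζ.im := by
  have hi := (L1.integrable_coeFn f).integrableOn (s := Ioi 1)
  calc ‖fourier f ζ‖ ≤ ∫ x in Ioi (1 : ℝ), Real.exp ζ.im * f x := by
        refine norm_integral_le_of_norm_le (hi.const_mul _) ?_
        filter_upwards [ae_restrict_mem measurableSet_Ioi, ae_restrict_of_ae hf.2.1] with x hx h0
        rw [norm_mul, norm_exp_neg_I_mul, Complex.norm_real, Real.norm_of_nonneg h0]
        refine mul_le_mul_of_nonneg_right (Real.exp_le_exp.2 ?_) h0
        have hx1 : (1 : ℝ) < x := hx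
        nlinarith
    _ = Real.exp ζ.im := by rw [integral_const_mul, hf.2.2, mul_one]

/-- The function `x ↦ β(log x) / x` on `[1,∞)`, extended by zero. -/
def traceProfile (β : ℝ → ℝ) : ℝ → ℝ :=
  indicator (Ici 1) fun x => β (Real.log x) / x

theorem truncFourier_traceProfile (β : ℝ → ℝ) {τ : ℝ} (hτ : 0 ≤ τ) (ζ : ℂ) :
    truncFourier (Real.exp τ) ζ (traceProfile β)
      = ∫ s in Ioi τ, (β s : ℂ) * Complex.exp (-Complex.I * (Real.exp s * ζ)) := by
  rw [truncFourier, ← image_exp_Ioi, integral_image_eq_integral_abs_deriv_smul measurableSet_Ioi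
    (fun s _ => (Real.hasDerivAt_exp s).hasDerivWithinAt) Real.exp_injective.injOn]
  refine setIntegral_congr_fun measurableSet_Ioi fun s hs => ?_
  have hs1 : Real.exp s ∈ Ici (1 : ℝ) := Real.one_le_exp (hτ.trans (le_of_lt hs))
  have hne : (Real.exp s : ℂ) ≠ 0 := Complex.ofReal_ne_zero.2 (Real.exp_ne_zero s)
  simp only [traceProfile, indicator_of_mem hs1, Real.log_exp, Real.abs_exp, Complex.real_smul,
    Complex.ofReal_div]
  field_simp

theorem integrableOn_exp_mul_traceProfile {β : ℝ → ℝ} {ε : ℝ}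
    (h : IntegrableOn (fun s => β s * Real.exp (-ε * Real.exp s)) (Ioi 0)) :
    IntegrableOn (fun x => Real.exp (-ε * x) * traceProfile β x) (Ioi 1) := by
  rw [← Real.exp_zero, ← image_exp_Ioi, integrableOn_image_iff_integrableOn_abs_deriv_smul
    measurableSet_Ioi (fun s _ => (Real.hasDerivAt_exp s).hasDerivWithinAt)
    Real.exp_injective.injOn]
  refine h.congr_fun (fun s hs => ?_) measurableSet_Ioi
  have hs1 : Real.exp s ∈ Ici (1 : ℝ) := Real.one_le_exp (le_of_lt hs)
  have hne := Real.exp_ne_zero s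
  simp only [traceProfile, indicator_of_mem hs1, Real.log_exp, Real.abs_exp, smul_eq_mul]
  field_simp

theorem integrableOn_exp_mul_dilation {w : ℝ → ℝ} {ε τ : ℝ} (hτ : 0 ≤ τ)
    (h : IntegrableOn (fun x => Real.exp (-(ε * Real.exp (-τ)) * x) * w x) (Ioi 1)) :
    IntegrableOn (fun x => Real.exp (-ε * x) * dilation τ w x) (Ioi 1) := by
  have h1 := ((h.integrable_indicator measurableSet_Ioi).comp_mul_left'
    (Real.exp_ne_zero τ)).const_mul (Real.exp τ)
  refine h1.integrableOn.congr_fun (fun x hx => ?_) measurableSet_Ioi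
  have hx1 : (1 : ℝ) < x := hx
  have h2 : Real.exp τ * x ∈ Ioi (1 : ℝ) := by
    have := Real.one_le_exp hτ
    exact mem_Ioi.2 (by nlinarith)
  have h3 : -(ε * Real.exp (-τ)) * (Real.exp τ * x) = -ε * x := by
    have : Real.exp (-τ) * Real.exp τ = 1 := by rw [← Real.exp_add]; simp
    linear_combination (-ε * x) * this
  simp only [indicator_of_mem h2, dilation, indicator_of_mem (mem_Ici.2 hx1.le), h3]
  ring

theorem dilationL1_zero {f : L1R} (hf : ∀ᵐ x, x < 1 → f x = 0) : dilationL1 0 f = f := by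
  conv_rhs => rw [← Integrable.toL1_coeFn f (L1.integrable_coeFn f)]
  rw [dilationL1, Integrable.toL1_eq_toL1_iff]
  filter_upwards [hf] with x hx
  by_cases hx1 : x ∈ Ici (1 : ℝ)
  · simp [dilation, indicator_of_mem hx1]
  · rw [dilation, indicator_of_notMem hx1, hx (not_le.1 hx1)]

section Solution

variable {N : ℕ} {p : ℕ → ℝ} {η₀ : L1R} {η : ℝ → L1R} {β : ℝ → ℝ}

theorem IsTrace.intervalIntegrable_mul_cexp (hβ : IsTrace η β) (ξ : ℂ) {a b : ℝ} (ha : 0 ≤ a)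
    (hb : 0 ≤ b) : IntervalIntegrable
      (fun s => (β s : ℂ) * Complex.exp (-Complex.I * (Real.exp s * ξ))) volume a b := by
  have h1 := hβ.intervalIntegrable ha hb
  have h2 : IntervalIntegrable (fun s => (β s : ℂ)) volume a b := ⟨h1.1.ofReal, h1.2.ofReal⟩
  exact h2.mul_continuousOn (by fun_prop)

theorem exp_mul_im_neg (s : ℝ) {ξ : ℂ} (hξ : ξ.im < 0) : ((Real.exp s : ℂ) * ξ).im < 0 := by
  rw [Complex.im_ofReal_mul]
  exact mul_neg_of_pos_of_neg (Real.exp_pos s) hξ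

theorem IsSolution.phi_fourier_eq (hp : ∀ j ∈ Finset.Icc 1 N, 0 ≤ p j)
    (hp1 : ∑ j ∈ Finset.Icc 1 N, p j = 1) (hη : IsSolution N p η₀ η) (hβ : IsTrace η β)
    (heq : ∀ τ : ℝ, 0 ≤ τ → η τ = dilationL1 τ η₀
      + ∫ s in (0 : ℝ)..τ, β s • dilationL1 (τ - s) (shiftQconvL1 N p (η s)))
    {T : ℝ} (hT : 0 ≤ T) {ξ : ℂ} (hξ : ξ.im < 0) :
    phi N p (fourier (η T) (Real.exp T * ξ)) = phi N p (fourier (η 0) (Real.exp 0 * ξ))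
      - ∫ s in (0 : ℝ)..T, (β s : ℂ) * Complex.exp (-Complex.I * (Real.exp s * ξ)) := by
  refine chain_rule_of_integral_eq (h := fun z => 1 - Qpoly N p z) (φ := phi N p)
    (y := fun s : ℝ => fourier (η s) (Real.exp s * ξ))
    (Real.log_pos one_lt_two) hT (continuous_const.sub (continuous_Qpoly N p))
    (fun z hz => ?_) (fun z hz => one_sub_Qpoly_ne_zero hp hp1 hz)
    (fun z hz => hasDerivAt_phi hp hp1 hz)
    (fun a b ha hb => hβ.intervalIntegrable_mul_cexp ξ ha hb) (fun t ht => ?_)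
    (fun s t hs hst ht => hη.fourier_sub_eq hβ heq hs hst ht hξ.le)
  · have h1 := norm_sub_le (1 : ℂ) (Qpoly N p z)
    have h2 := norm_Qpoly_le hp hp1 hz.le
    rw [norm_one] at h1
    linarith
  · have him := exp_mul_im_neg t hξ
    exact (norm_fourier_le_exp (hη.mem t ht) him.le).trans_lt (Real.exp_lt_one_iff.2 him)

theorem IsSolution.tendsto_phi_fourier (hp : ∀ j ∈ Finset.Icc 1 N, 0 ≤ p j)
    (hp1 : ∑ j ∈ Finset.Icc 1 N, p j = 1) (hη : IsSolution N p η₀ η) {ξ : ℂ} (hξ : ξ.im < 0) :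
    Tendsto (fun T : ℝ => phi N p (fourier (η T) (Real.exp T * ξ))) atTop (𝓝 0) := by
  have h0 : Tendsto (fun T : ℝ => fourier (η T) (Real.exp T * ξ)) atTop (𝓝 0) := by
    have h1 : Tendsto (fun T : ℝ => Real.exp (Real.exp T * ξ.im)) atTop (𝓝 0) :=
      Real.tendsto_exp_atBot.comp (Real.tendsto_exp_atTop.atTop_mul_const_of_neg hξ)
    refine squeeze_zero_norm' ?_ h1
    filter_upwards [eventually_ge_atTop 0] with T hT
    have := norm_fourier_le_exp (hη.mem T hT) (exp_mul_im_neg T hξ).le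
    rwa [Complex.im_ofReal_mul] at this
  have h2 := (hasDerivAt_phi hp hp1 (z := 0) (by simp)).continuousAt.tendsto.comp h0
  rwa [phi_zero] at h2

/-- The integrand is nonnegative almost everywhere, so convergence of its integrals over `[0, T]`,
read off from the limit of `φ` along the characteristic, already gives integrability. -/
theorem IsSolution.integrableOn_mul_exp (hp : ∀ j ∈ Finset.Icc 1 N, 0 ≤ p j)
    (hp1 : ∑ j ∈ Finset.Icc 1 N, p j = 1) (hη : IsSolution N p η₀ η) (hβ : IsTrace η β)
    (heq : ∀ τ : ℝ, 0 ≤ τ → η τ = dilationL1 τ η₀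
      + ∫ s in (0 : ℝ)..τ, β s • dilationL1 (τ - s) (shiftQconvL1 N p (η s)))
    {ε : ℝ} (hε : 0 < ε) :
    IntegrableOn (fun s => β s * Real.exp (-ε * Real.exp s)) (Ioi 0) := by
  -- At `ξ = -iε` the oscillating factor `e^{-i e^s ξ}` is the real weight `e^{-ε e^s}`.
  set ξ : ℂ := -(Complex.I * ε) with hξdef
  have hξ : ξ.im < 0 := by simpa [hξdef] using hε
  have hk : ∀ s : ℝ, (β s : ℂ) * Complex.exp (-Complex.I * (Real.exp s * ξ))
      = ((β s * Real.exp (-ε * Real.exp s) : ℝ) : ℂ) := by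
    intro s
    rw [Complex.ofReal_mul, Complex.ofReal_exp (-ε * Real.exp s)]
    congr 2
    rw [hξdef]
    push_cast
    linear_combination (Complex.exp s * ε) * Complex.I_mul_I
  have hii : ∀ T, 0 ≤ T →
      IntervalIntegrable (fun s => β s * Real.exp (-ε * Real.exp s)) volume 0 T := fun T hT =>
    (hβ.intervalIntegrable le_rfl hT).mul_continuousOn (by fun_prop)
  have hlim := (hη.tendsto_phi_fourier hp hp1 hξ).const_sub
    (phi N p (fourier (η 0) (Real.exp 0 * ξ)))
  have hre := (Complex.continuous_re.tendsto _).comp hlim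
  refine integrableOn_Ioi_of_intervalIntegral_norm_tendsto _ 0 (l := atTop) (b := id)
    (fun T => ?_) tendsto_id (hre.congr' ?_)
  · rcases le_total 0 T with hT | hT
    · exact (intervalIntegrable_iff_integrableOn_Ioc_of_le hT).1 (hii T hT)
    · simp [Ioc_eq_empty (not_lt.2 hT)]
  · filter_upwards [eventually_ge_atTop 0] with T hT
    have h1 := hη.phi_fourier_eq hp hp1 hβ heq hT hξ
    simp only [Function.comp_apply, id_eq]
    rw [h1, sub_sub_cancel]
    simp only [hk]
    rw [intervalIntegral.integral_ofReal, Complex.ofReal_re]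
    refine intervalIntegral.integral_congr_ae ?_
    filter_upwards [hβ.ae_nonneg hη.mem] with s hs hsm
    rw [uIoc_of_le hT] at hsm
    rw [Real.norm_of_nonneg (mul_nonneg (hs hsm.1.le) (Real.exp_pos _).le)]

theorem IsSolution.phi_fourier_eq_integral_Ioi (hp : ∀ j ∈ Finset.Icc 1 N, 0 ≤ p j)
    (hp1 : ∑ j ∈ Finset.Icc 1 N, p j = 1) (hη : IsSolution N p η₀ η) (hβ : IsTrace η β)
    (heq : ∀ τ : ℝ, 0 ≤ τ → η τ = dilationL1 τ η₀
      + ∫ s in (0 : ℝ)..τ, β s • dilationL1 (τ - s) (shiftQconvL1 N p (η s)))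
    {τ : ℝ} (hτ : 0 ≤ τ) {ξ : ℂ} (hξ : ξ.im < 0) :
    phi N p (fourier (η τ) (Real.exp τ * ξ))
      = ∫ s in Ioi τ, (β s : ℂ) * Complex.exp (-Complex.I * (Real.exp s * ξ)) := by
  have hreal := hη.integrableOn_mul_exp hp hp1 hβ heq (neg_pos.2 hξ)
  have hnorm : ∀ s : ℝ, ‖(β s : ℂ) * Complex.exp (-Complex.I * (Real.exp s * ξ))‖
      = ‖β s * Real.exp (- -ξ.im * Real.exp s)‖ := by
    intro s
    rw [norm_mul, norm_mul, Complex.norm_real, Real.norm_eq_abs (Real.exp _), Real.abs_exp,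
      Complex.norm_exp]
    congr 2
    simp [mul_comm, Complex.exp_ofReal_im, Complex.exp_ofReal_re]
  have hmeas : AEStronglyMeasurable
      (fun s => (β s : ℂ) * Complex.exp (-Complex.I * (Real.exp s * ξ)))
      (volume.restrict (Ioi 0)) := by
    -- The two exponentials cancel, which recovers measurability of `β` itself on the half line.
    have h1 : AEStronglyMeasurable (fun s => β s * Real.exp (- -ξ.im * Real.exp s)
        * Real.exp (-ξ.im * Real.exp s)) (volume.restrict (Ioi 0)) :=
      hreal.aestronglyMeasurable.mul (by fun_prop)
    have h2 : AEStronglyMeasurable (fun s => (β s : ℂ)) (volume.restrict (Ioi 0)) := by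
      refine (Complex.continuous_ofReal.comp_aestronglyMeasurable h1).congr
        (Eventually.of_forall fun s => ?_)
      simp only [mul_assoc, ← Real.exp_add]
      simp
    exact h2.mul (by fun_prop)
  have hint : IntegrableOn (fun s => (β s : ℂ) * Complex.exp (-Complex.I * (Real.exp s * ξ)))
      (Ioi τ) :=
    IntegrableOn.mono_set (Integrable.mono hreal hmeas (Eventually.of_forall fun s => (hnorm s).le))
      (Ioi_subset_Ioi hτ)
  have hlim1 := intervalIntegral_tendsto_integral_Ioi τ hint tendsto_id
  have hlim2 := (hη.tendsto_phi_fourier hp hp1 hξ).const_sub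
    (phi N p (fourier (η τ) (Real.exp τ * ξ)))
  rw [sub_zero] at hlim2
  refine tendsto_nhds_unique (hlim2.congr' ?_) hlim1
  filter_upwards [eventually_ge_atTop 0] with T hT
  rw [hη.phi_fourier_eq hp hp1 hβ heq hT hξ, hη.phi_fourier_eq hp hp1 hβ heq hτ hξ, id_eq,
    ← intervalIntegral.integral_interval_sub_left
      (hβ.intervalIntegrable_mul_cexp ξ le_rfl hT) (hβ.intervalIntegrable_mul_cexp ξ le_rfl hτ)]
  ring

/-- The core of the theorem: one profile, independent of `τ`, represents `𝒩(η(τ))` after dilation.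
The identity along characteristics is applied at frequency `e^{-τ} ξ`. -/
theorem IsSolution.hasFourier_dilation_traceProfile (hp : ∀ j ∈ Finset.Icc 1 N, 0 ≤ p j)
    (hp1 : ∑ j ∈ Finset.Icc 1 N, p j = 1) (hη : IsSolution N p η₀ η) (hβ : IsTrace η β)
    (heq : ∀ τ : ℝ, 0 ≤ τ → η τ = dilationL1 τ η₀
      + ∫ s in (0 : ℝ)..τ, β s • dilationL1 (τ - s) (shiftQconvL1 N p (η s)))
    {τ : ℝ} (hτ : 0 ≤ τ) :
    HasFourier (dilation τ (traceProfile β)) fun ξ => phi N p (fourier (η τ) ξ) := by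
  have hexp : ∀ ε : ℝ, 0 < ε →
      IntegrableOn (fun x => Real.exp (-ε * x) * dilation τ (traceProfile β) x) (Ioi 1) :=
    fun ε hε => integrableOn_exp_mul_dilation hτ (integrableOn_exp_mul_traceProfile
      (hη.integrableOn_mul_exp hp hp1 hβ heq (mul_pos hε (Real.exp_pos _))))
  refine ⟨fun x hx => indicator_of_notMem (not_le.2 hx) _, ?_, hexp, fun ξ hξ => ?_⟩
  -- Local integrability: take `ε = 1` and multiply back by the continuous function `e^x`.
  · have h1 := ((integrableOn_Ici_iff_integrableOn_Ioi).2
      (hexp 1 one_pos)).locallyIntegrableOn.continuousOn_mul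
      (Real.continuous_exp.continuousOn (s := Ici 1)) isClosed_Ici.isLocallyClosed
    refine h1.congr (Eventually.of_forall fun x => ?_)
    simp only [← mul_assoc, ← Real.exp_add]
    simp
  · change truncFourier 1 ξ _ = _
    rw [truncFourier_dilation le_rfl, mul_one, truncFourier_traceProfile β hτ,
      ← hη.phi_fourier_eq_integral_Ioi hp hp1 hβ heq hτ (exp_mul_im_neg (-τ) hξ), ← mul_assoc,
      ← Complex.ofReal_mul, ← Real.exp_add, add_neg_cancel, Real.exp_zero, Complex.ofReal_one,
      one_mul]

end Solution

end Coarsening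

end

/-- The first conjunct says that `𝒩(η(τ))` is defined, i.e. that the inverse Fourier transform in
its definition exists in `L¹_loc([1,∞))`; the second one is the conjugation formula. -/
theorem proposition3p4 (N : ℕ) (p : ℕ → ℝ)
    (hp : ∀ j ∈ Finset.Icc 1 N, 0 ≤ p j) (hp1 : ∑ j ∈ Finset.Icc 1 N, p j = 1)
    (η₀ : Coarsening.L1R) (hη₀ : η₀ ∈ Coarsening.probDensities)
    (η : ℝ → Coarsening.L1R) (hη : Coarsening.IsSolution N p η₀ η) :
    ∀ τ : ℝ, 0 ≤ τ →
      Coarsening.HasFourier (Coarsening.Nmap N p (η τ))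
          (fun ξ => Coarsening.phi N p (Coarsening.fourier (η τ) ξ)) ∧
        Coarsening.Nmap N p (η τ) =ᵐ[MeasureTheory.volume]
          Coarsening.dilation τ (Coarsening.Nmap N p η₀) := by
  obtain ⟨β, hβ, heq⟩ := hη.integral_eq
  have hprofile := fun {τ : ℝ} (hτ : 0 ≤ τ) =>
    hη.hasFourier_dilation_traceProfile hp hp1 hβ heq hτ
  have hη0 : η 0 = η₀ := by
    rw [heq 0 le_rfl, intervalIntegral.integral_same, add_zero,
      Coarsening.dilationL1_zero hη₀.1]
  have hdil0 : Coarsening.dilation 0 (Coarsening.traceProfile β) = Coarsening.traceProfile β := by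
    ext x
    by_cases hx : x ∈ Set.Ici (1 : ℝ)
    · simp [Coarsening.dilation, Set.indicator_of_mem hx]
    · simp [Coarsening.dilation, Coarsening.traceProfile, Set.indicator_of_notMem hx]
  have h0 := hprofile le_rfl
  rw [hη0, hdil0] at h0
  intro τ hτ
  -- `fourierInv` is a choice of representative, so at `τ` and at `0` it is compared with the
  -- profile through almost-everywhere uniqueness.
  have hN := Coarsening.hasFourier_fourierInv (hprofile hτ)
  exact ⟨hN, (hN.ae_eq (hprofile hτ)).trans
    (Coarsening.dilation_congr_ae τ (h0.ae_eq (Coarsening.hasFourier_fourierInv h0)))⟩
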